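/- **Model.** There are $M$ agents, a server, a $K$-armed bandit whose arm $k$ has an unknown reward distribution $\mathcal P_k$ on $[0,1]$ with mean $\mu(k)$, and a horizon $T$. At each time step $t=1,\dots,T$ every agent $i$ pulls an arm $a_{t,i}$ and observes a reward drawn independently from $\mathcal P_{a_{t,i}}$. Immediately before each pull there are at most $R$ rounds of communication with zero latency; in a round every agent sends a (possibly empty) sequence of packets to the server, and then the server sends a (possibly empty) sequence of packets to every agent. A packet carries one integer of $O(\log T)$ bits, that is, one integer in $\{0,\dots,T^{b}-1\}$. All randomness of the protocol is private: every agent and the server has its own random seed, the seeds are mutually independent and independent of the rewards, and whatever a party sends or pulls is a function of its own seed, of the packets it has received and (for an agent) of the rewards it has observed. The protocol may depend on $M,K,T$ but not on the bandit. The total regret is $REG(T)=\sum_{t=1}^{T}\sum_{i=1}^{M}\bigl(\max_k\mu(k)-\mu(a_{t,i})\bigr)$, and the communication cost is the total number of packets sent between server and agents. **Theorem.** There are universal constants $C$, $b$ and $R$ such that for all integers $M,K\ge 1$ and $T>\max\{\frac{M\log M}{K},M,K,2\}$ there is a protocol as above (without public randomness) with the following properties. 1. In every execution (worst case) the communication cost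 is at most $C\,(M\log(MK)+K)$. 2. On every $K$-armed bandit with rewards in $[0,1]$, the expected regret is at most $C\sqrt{MKT\log T}$. 3. On every such bandit, the expected communication cost is at most $C\,M\log(MK)$. -/

import Mathlib

open MeasureTheory
open scoped unitInterval

namespace DistributedMAB

/-- A `K`-armed stochastic bandit: each arm has a reward distribution on `[0, 1]`. -/
abbrev Bandit (K : ℕ) : Type := Fin K → ProbabilityMeasure I

/-- The mean reward of an arm. -/
noncomputable def Bandit.mean {K : ℕ} (ν : Bandit K) (k : Fin K) : ℝ :=
  ∫ x : I, (x : ℝ) ∂(ν k : Measure I)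

/-- The mean reward of the best arm. -/
noncomputable def Bandit.bestMean {K : ℕ} (ν : Bandit K) : ℝ :=
  ⨆ k : Fin K, ν.mean k

/-- A message: a finite (possibly empty) sequence of packets, each packet being an integer in
`{0, …, q - 1}`. -/
abbrev Message (q : ℕ) : Type := List (Fin q)

/-- A communication protocol between `M` agents and a server, for bandits with `K` arms.
A packet carries an integer in `{0, …, q - 1}`. Before each pull of arms there are `R` exchanges;
in an exchange every agent sends a message to the server, and then the server sends a message to
every agent. All randomness is private: every agent and the server has a random seed of its own,
everything else is a deterministic (measurable) function of the local memory of one party.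
The memory types are arbitrary, so that a party can remember everything it has seen. -/
structure Protocol (M K R q : ℕ) where
  /-- Values of the private random seeds. -/
  Seed : Type
  /-- Memory of an agent. -/
  AgentState : Type
  /-- Memory of the server. -/
  ServerState : Type
  [seedMeas : MeasurableSpace Seed]
  [agentMeas : MeasurableSpace AgentState]
  [serverMeas : MeasurableSpace ServerState]
  /-- Law of the private seed of each agent. -/
  agentSeed : Fin M → ProbabilityMeasure Seed
  /-- Law of the private seed of the server. -/
  serverSeed : ProbabilityMeasure Seed
  /-- Initial memory of an agent, from its own seed. -/
  agentInit : Fin M → Seed → AgentState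
  /-- Initial memory of the server, from its own seed. -/
  serverInit : Seed → ServerState
  /-- Message from an agent to the server. -/
  agentSend : Fin M → AgentState → Message q
  /-- Memory of the server after it has received one message from each agent. -/
  serverRecv : ServerState → (Fin M → Message q) → ServerState
  /-- Message from the server to an agent. -/
  serverSend : ServerState → Fin M → Message q
  /-- Memory of an agent after it has received a message from the server. -/
  agentRecv : Fin M → AgentState → Message q → AgentState
  /-- The arm that an agent pulls. -/
  arm : Fin M → AgentState → Fin K
  /-- Memory of an agent after it has observed the reward of its pull. -/
  observe : Fin M → AgentState → I → AgentState
  measurable_agentInit : ∀ i, Measurable (agentInit i)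
  measurable_serverInit : Measurable serverInit
  measurable_agentSend : ∀ i, Measurable[agentMeas, ⊤] (agentSend i)
  measurable_serverRecv : ∀ m, Measurable fun s => serverRecv s m
  measurable_serverSend : ∀ i, Measurable[serverMeas, ⊤] fun s => serverSend s i
  measurable_agentRecv : ∀ i m, Measurable fun s => agentRecv i s m
  measurable_arm : ∀ i, Measurable (arm i)
  measurable_observe : ∀ i, Measurable fun p : AgentState × I => observe i p.1 p.2

attribute [instance] Protocol.seedMeas Protocol.agentMeas Protocol.serverMeas

namespace Protocol

variable {M K R q : ℕ}

/-- A global configuration: all memories, and the number of packets sent so far. -/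
structure Config (P : Protocol M K R q) where
  agents : Fin M → P.AgentState
  server : P.ServerState
  packets : ℕ

/-- One exchange: all agents send to the server, then the server sends to all agents. -/
def exchange (P : Protocol M K R q) (c : P.Config) : P.Config :=
  let up : Fin M → Message q := fun i => P.agentSend i (c.agents i)
  let server' : P.ServerState := P.serverRecv c.server up
  let down : Fin M → Message q := fun i => P.serverSend server' i
  { agents := fun i => P.agentRecv i (c.agents i) (down i)
    server := server'
    packets := c.packets + ∑ i, (up i).length + ∑ i, (down i).length }

/-- The `R` exchanges that precede a pull. -/
def communicate (P : Protocol M K R q) (c : P.Config) : P.Config :=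
  P.exchange^[R] c

/-- Every agent `i` pulls an arm; it observes the reward `x i k` if it has pulled arm `k`. -/
def pull (P : Protocol M K R q) (x : Fin M → Fin K → I) (c : P.Config) : P.Config :=
  { c with agents := fun i => P.observe i (c.agents i) (x i (P.arm i (c.agents i))) }

/-- A realization of all the randomness in `T` time steps: the seeds of the agents, the seed of
the server, and the table of rewards. The entry `(t, i, k)` of the table is the reward that agent
`i` gets at time `t` if it pulls arm `k`. -/
abbrev Outcome (P : Protocol M K R q) (T : ℕ) : Type :=
  (Fin M → P.Seed) × P.Seed × (Fin T × Fin M × Fin K → I)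

/-- The law of the randomness: all the seeds and all the rewards are mutually independent, and the
rewards of arm `k` have the law `ν k`. -/
noncomputable def law (P : Protocol M K R q) (T : ℕ) (ν : Bandit K) : Measure (P.Outcome T) :=
  (Measure.pi fun i => (P.agentSeed i : Measure P.Seed)).prod
    ((P.serverSeed : Measure P.Seed).prod
      (Measure.pi fun e : Fin T × Fin M × Fin K => (ν e.2.2 : Measure I)))

/-- The configuration after `n` time steps (with nothing happening after time `T`). -/
def config (P : Protocol M K R q) {T : ℕ} (ω : P.Outcome T) : ℕ → P.Config
  | 0 => { agents := fun i => P.agentInit i (ω.1 i)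
           server := P.serverInit ω.2.1
           packets := 0 }
  | n + 1 =>
      if h : n < T then
        P.pull (fun i k => ω.2.2 (⟨n, h⟩, i, k)) (P.communicate (P.config ω n))
      else P.config ω n

/-- The arm that agent `i` pulls at time step `t`. -/
def pulledArm (P : Protocol M K R q) {T : ℕ} (ω : P.Outcome T) (t : Fin T) (i : Fin M) : Fin K :=
  P.arm i ((P.communicate (P.config ω t)).agents i)

/-- The total regret of all agents over `T` time steps. -/
noncomputable def regret (P : Protocol M K R q) {T : ℕ} (ν : Bandit K) (ω : P.Outcome T) : ℝ :=
  ∑ t : Fin T, ∑ i : Fin M, (ν.bestMean - ν.mean (P.pulledArm ω t i))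

/-- The communication cost: the number of packets sent between server and agents. -/
def cost (P : Protocol M K R q) {T : ℕ} (ω : P.Outcome T) : ℕ :=
  (P.config ω T).packets

end Protocol

end DistributedMAB

/-! The protocol is deterministic successive elimination in epochs of doubling length. While `M * 2
^ j < T` an epoch is local: every agent samples all arms in round-robin order and eliminates by
itself, without communication. Afterwards gaps are of order `√(K log T / 2 ^ j)`, and since local
epochs cover only about `T / M` steps, `M` agents lose `O(√(M K T log T))` there. At most `log₂ M`
completed epochs are followed by communication, with at most five packets per agent each, so the
cost is `O(M log M)` in every execution. The worst-case and the expected cost bounds both follow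
from this.

In a global epoch the arms are divided among the agents and samples are pooled, so gaps shrink like
`√(K log T / (M * 2 ^ j))`. One report per agent suffices. If `M ≤ K`, every arm has a single owner,
whose own sum is already the total; the owner reports only its best arm and compares its other arms
with the broadcast maximum. If `K < M`, every agent owns at most one arm, and the server returns the
total of that arm. Owners may have eliminated different arms in local epochs, so the server uses an
arm only if all its owners report it. The best arm is never eliminated by an owner, so the leader is
at least as good as it, up to the accuracy (`Collected.top_mem_pooled`,
`Collected.sum_le_sum_leader`).

The schedule does not depend on the rewards: the slot of an eliminated arm is spent on the fallback
arm, the empirical winner of the preceding epoch. Hence every sum of an active arm runs over a fixed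
set of entries of the reward table, and Hoeffding's inequality with a union bound gives the event
`Accurate`, whose complement has probability at most `1 / T`. On this event the invariant `Sound`
holds throughout (`sound_synced`), which bounds the gap of every pulled arm; `sum_gapBound_le` adds
these bounds up. Rewards are rounded to multiples of `1 / T`, which makes sums fit in packets and
memories countable, at the price of an error absorbed in `width`. -/

namespace DistributedMAB.Elimination

/-! ### Epochs, division of the arms, and the fixed sampling schedule -/

/-- The epoch of a time step: epoch `j` consists of the `2 ^ j` steps from `2 ^ j - 1` on. -/
def epoch (n : ℕ) : ℕ := Nat.log 2 (n + 1)

/-- Number of groups of agents (and of arms) in a global epoch. -/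
def groups (M K : ℕ) : ℕ := min M K

/-- Number of agents in a group. -/
def groupSize (M K : ℕ) : ℕ := M / groups M K

/-- Upper bound for the number of arms in a group. -/
def groupArms (M K : ℕ) : ℕ := (K - 1) / groups M K + 1

/-- In a local epoch the agents explore all arms on their own. -/
def IsLocal (M T j : ℕ) : Prop := M * 2 ^ j < T

/-- In a global epoch, agent `i` is in charge of arm `k`. -/
def Owns (M K i k : ℕ) : Prop :=
  i / groups M K < groupSize M K ∧ i % groups M K = k % groups M K

open Classical in
/-- At time step `n`, agent `i` is scheduled to sample arm `k`. -/
def IsSlot (M K T n i k : ℕ) : Prop :=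
  if IsLocal M T (epoch n) then
    (n + 1 - 2 ^ epoch n) % K = k ∧ (n + 1 - 2 ^ epoch n) / K < 2 ^ epoch n / K
  else
    Owns M K i k ∧ (n + 1 - 2 ^ epoch n) % groupArms M K = k / groups M K ∧
      (n + 1 - 2 ^ epoch n) / groupArms M K < 2 ^ epoch n / groupArms M K

open Classical in
/-- Number of samples of an arm in epoch `j`. -/
noncomputable def samples (M K T j : ℕ) : ℕ :=
  if IsLocal M T j then 2 ^ j / K else groupSize M K * (2 ^ j / groupArms M K)

section

variable {M K T : ℕ}

theorem epoch_eq_iff {n j : ℕ} : epoch n = j ↔ 2 ^ j ≤ n + 1 ∧ n + 1 < 2 ^ (j + 1) := by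
  unfold epoch
  exact Nat.log_eq_iff (Or.inr ⟨by norm_num, by omega⟩)

theorem epoch_zero : epoch 0 = 0 := by simp [epoch]

theorem two_pow_epoch_le (n : ℕ) : 2 ^ epoch n ≤ n + 1 := (epoch_eq_iff.1 rfl).1

theorem lt_two_pow_epoch (n : ℕ) : n + 1 < 2 ^ (epoch n + 1) := (epoch_eq_iff.1 rfl).2

theorem epoch_succ_of_ne {n : ℕ} (h : epoch n ≠ epoch (n + 1)) :
    epoch (n + 1) = epoch n + 1 ∧ n + 2 = 2 ^ (epoch n + 1) := by
  have h1 := lt_two_pow_epoch n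
  have h0 := two_pow_epoch_le n
  have h2 : 2 ^ (epoch n + 1) ≤ n + 2 := by
    by_contra hc
    exact h (epoch_eq_iff.2 ⟨by omega, by omega⟩).symm
  have h3 : n + 2 = 2 ^ (epoch n + 1) := by omega
  refine ⟨epoch_eq_iff.2 ⟨by omega, ?_⟩, h3⟩
  rw [pow_succ 2 (epoch n + 1)]
  omega

theorem epoch_lt_of_lt {n : ℕ} (h : n < T) : epoch n < T := by
  have := two_pow_epoch_le n
  have := (epoch n).lt_two_pow_self
  omega

theorem groups_pos (hM : 0 < M) (hK : 0 < K) : 0 < groups M K := lt_min hM hK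

theorem groupSize_pos (hM : 0 < M) (hK : 0 < K) : 0 < groupSize M K :=
  Nat.div_pos (min_le_left _ _) (groups_pos hM hK)

theorem groupArms_pos : 0 < groupArms M K := Nat.succ_pos _

theorem div_groups_lt {k : ℕ} (hk : k < K) : k / groups M K < groupArms M K :=
  Nat.lt_succ_of_le (Nat.div_le_div_right (by omega))

theorem groupSize_eq_one (hM : 0 < M) (h : M ≤ K) : groupSize M K = 1 := by
  simp [groupSize, groups, min_eq_left h, Nat.div_self hM]

theorem groups_eq_of_lt (h : K < M) : groups M K = K := min_eq_right h.le

/-- In a global epoch ownership fixes the residue of the arm modulo the number of groups and the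
clock fixes its quotient, so the arm is determined. -/
theorem isSlot_unique {n i k k' : ℕ}
    (h : IsSlot M K T n i k) (h' : IsSlot M K T n i k') : k = k' := by
  unfold IsSlot at h h'
  split_ifs at h h' with hl
  · exact h.1.symm.trans h'.1
  · have h1 := h.2.1.symm.trans h'.2.1
    have h2 : k % groups M K = k' % groups M K := h.1.2.symm.trans h'.1.2
    rw [← Nat.div_add_mod k (groups M K), ← Nat.div_add_mod k' (groups M K), h1, h2]

/-- With fewer arms than agents there are `K` groups, so the residue is the arm itself. -/
theorem Owns.arm_eq (hKM : K < M) {i k k' : ℕ} (hk : k < K) (hk' : k' < K)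
    (h : Owns M K i k) (h' : Owns M K i k') : k = k' := by
  have := h.2.symm.trans h'.2
  rwa [groups_eq_of_lt hKM, Nat.mod_eq_of_lt hk, Nat.mod_eq_of_lt hk'] at this

/-- Each of the `c` full rounds of length `a` after the offset `o` meets the residue `p` once. It
counts both time slots and owners. -/
theorem card_residue (X a p c o : ℕ) (hp : p < a) (h : o + c * a ≤ X) :
    ((Finset.univ : Finset (Fin X)).filter fun t : Fin X =>
      o ≤ (t : ℕ) ∧ ((t : ℕ) - o) % a = p ∧ ((t : ℕ) - o) / a < c).card = c := by
  classical
  have ha : 0 < a := by omega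
  have key : ∀ q < c, o + (q * a + p) < X := by
    intro q hq
    have : (q + 1) * a ≤ c * a := Nat.mul_le_mul_right _ hq
    rw [add_mul] at this
    omega
  conv_rhs => rw [← Finset.card_range c]
  symm
  refine Finset.card_bij (fun q hq => ⟨o + (q * a + p), key q (Finset.mem_range.1 hq)⟩) ?_ ?_ ?_
  · intro q hq
    simp only [Finset.mem_filter, Finset.mem_univ, true_and]
    refine ⟨by omega, ?_, ?_⟩
    · rw [Nat.add_sub_cancel_left, Nat.mul_comm, Nat.mul_add_mod, Nat.mod_eq_of_lt hp]
    · rw [Nat.add_sub_cancel_left, Nat.mul_comm, Nat.mul_add_div ha, Nat.div_eq_of_lt hp]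
      simpa using hq
  · intro q _ q' _ he
    have : q * a = q' * a := by
      have := congrArg Fin.val he
      simp only at this
      omega
    exact Nat.eq_of_mul_eq_mul_right ha this
  · intro t ht
    simp only [Finset.mem_filter, Finset.mem_univ, true_and] at ht
    refine ⟨((t : ℕ) - o) / a, Finset.mem_range.2 ht.2.2, Fin.ext ?_⟩
    have := Nat.div_add_mod ((t : ℕ) - o) a
    simp only
    rw [Nat.mul_comm] at this
    omega

open Classical in
/-- The entries of the reward table that are sampled for arm `k` in epoch `j` by one agent
(`o = some i`) or by all agents (`o = none`). -/
noncomputable def sampled (M K T j : ℕ) (o : Option (Fin M)) (k : Fin K) :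
    Finset (Fin T × Fin M × Fin K) :=
  Finset.univ.filter fun e =>
    (∀ i ∈ o, e.2.1 = i) ∧ epoch e.1 = j ∧ IsSlot M K T e.1 e.2.1 k ∧ e.2.2 = k

open Classical in
theorem card_sampled_local {j : ℕ} (hj : IsLocal M T j) (hT : 2 ^ (j + 1) ≤ T + 1)
    (i : Fin M) (k : Fin K) : (sampled M K T j (some i) k).card = samples M K T j := by
  have : sampled M K T j (some i) k =
      ((Finset.univ : Finset (Fin T)).filter fun t : Fin T =>
        2 ^ j - 1 ≤ (t : ℕ) ∧ ((t : ℕ) - (2 ^ j - 1)) % K = k ∧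
          ((t : ℕ) - (2 ^ j - 1)) / K < 2 ^ j / K) ×ˢ ({i} ×ˢ {k}) := by
    ext ⟨t, i', k'⟩
    have hp : 0 < 2 ^ j := by positivity
    have hs : (t : ℕ) + 1 - 2 ^ j = t - (2 ^ j - 1) := by omega
    simp only [sampled, Finset.mem_filter, Finset.mem_univ, true_and, Finset.mem_product,
      Finset.mem_singleton, Option.mem_some_iff, forall_eq']
    constructor
    · rintro ⟨h1, h2, h3, h4⟩
      have h5 := two_pow_epoch_le (t : ℕ)
      simp only [IsSlot, h2, hj, if_true, hs] at h3
      rw [h2] at h5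
      exact ⟨⟨by omega, h3⟩, h1, h4⟩
    · rintro ⟨⟨h0, h3⟩, h1, h4⟩
      -- Only full rounds are counted, so a slot cannot lie beyond the end of the epoch.
      have hlt : (t : ℕ) - (2 ^ j - 1) < 2 ^ j := by
        by_contra hc
        have := Nat.div_le_div_right (c := K) (not_lt.1 hc)
        omega
      have h2 : epoch t = j := epoch_eq_iff.2 ⟨by omega, by rw [pow_succ]; omega⟩
      refine ⟨h1, h2, ?_, h4⟩
      simp only [IsSlot, h2, hj, if_true, hs]
      exact h3
  rw [this, Finset.card_product, card_residue _ _ _ _ _ k.2]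
  · simp [samples, hj]
  · have := Nat.div_mul_le_self (2 ^ j) K
    rw [pow_succ] at hT
    have : 0 < 2 ^ j := by positivity
    omega

theorem card_owners (hM : 0 < M) (k : Fin K) [DecidablePred fun i : Fin M => Owns M K i k] :
    ((Finset.univ : Finset (Fin M)).filter fun i : Fin M => Owns M K i k).card = groupSize M K := by
  have hg := groups_pos hM (Fin.pos k)
  rw [← card_residue M (groups M K) (k % groups M K) (groupSize M K) 0 (Nat.mod_lt _ hg)
    (by rw [zero_add]; exact Nat.div_mul_le_self M (groups M K))]
  congr 1
  ext i
  simp [Owns, and_comm]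

open Classical in
theorem card_sampled_global (hM : 0 < M) {j : ℕ} (hj : ¬ IsLocal M T j)
    (hT : 2 ^ (j + 1) ≤ T + 1) (k : Fin K) :
    (sampled M K T j none k).card = samples M K T j := by
  have : sampled M K T j none k =
      ((Finset.univ : Finset (Fin T)).filter fun t : Fin T =>
        2 ^ j - 1 ≤ (t : ℕ) ∧ ((t : ℕ) - (2 ^ j - 1)) % groupArms M K = k / groups M K ∧
          ((t : ℕ) - (2 ^ j - 1)) / groupArms M K < 2 ^ j / groupArms M K) ×ˢ
        (((Finset.univ : Finset (Fin M)).filter fun i : Fin M => Owns M K i k) ×ˢ {k}) := by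
    ext ⟨t, i', k'⟩
    have hp : 0 < 2 ^ j := by positivity
    have hs : (t : ℕ) + 1 - 2 ^ j = t - (2 ^ j - 1) := by omega
    simp only [sampled, Finset.mem_filter, Finset.mem_univ, true_and, Finset.mem_product,
      Finset.mem_singleton, Option.not_mem_none, false_imp_iff, implies_true]
    constructor
    · rintro ⟨h2, h3, h4⟩
      have h5 := two_pow_epoch_le (t : ℕ)
      simp only [IsSlot, h2, hj, if_false, hs] at h3
      rw [h2] at h5
      exact ⟨⟨by omega, h3.2⟩, h3.1, h4⟩
    · rintro ⟨⟨h0, h3⟩, h1, h4⟩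
      have hlt : (t : ℕ) - (2 ^ j - 1) < 2 ^ j := by
        by_contra hc
        have := Nat.div_le_div_right (c := groupArms M K) (not_lt.1 hc)
        omega
      have h2 : epoch t = j := epoch_eq_iff.2 ⟨by omega, by rw [pow_succ]; omega⟩
      refine ⟨h2, ?_, h4⟩
      simp only [IsSlot, h2, hj, if_false, hs]
      exact ⟨h1, h3⟩
  rw [this, Finset.card_product, Finset.card_product, card_owners hM,
    card_residue _ _ _ _ _ (div_groups_lt k.2)]
  · simp [samples, hj, mul_comm]
  · have := Nat.div_mul_le_self (2 ^ j) (groupArms M K)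
    rw [pow_succ] at hT
    have : 0 < 2 ^ j := by positivity
    omega

theorem Owns.agent_eq (hM : 0 < M) (hMK : M ≤ K) {i i' : Fin M} {k : Fin K}
    (hi : Owns M K i k) (hi' : Owns M K i' k) : i = i' := by
  classical
  have hc := card_owners hM k
  rw [groupSize_eq_one hM hMK] at hc
  exact Finset.card_le_one.1 hc.le i (by simpa using hi) i' (by simpa using hi')

/-- A floor is at least half of the quotient unless it vanishes. -/
theorem le_two_mul_div {x a : ℕ} (ha : 0 < a) (h : a ≤ x) : x ≤ 2 * a * (x / a) := by
  have h1 := Nat.div_add_mod x a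
  have h2 := Nat.mod_lt x ha
  have h3 : 1 ≤ x / a := Nat.div_pos h ha
  nlinarith

/-- The second alternative is an epoch too short for one full round; the gap bound that it has to
support is then trivial. `samples_global` has the same form with `M * 2 ^ j` pulls. -/
theorem samples_local {j : ℕ} (hK : 0 < K) (hj : IsLocal M T j) :
    2 ^ j ≤ 4 * K * samples M K T j ∨ samples M K T j = 0 ∧ 2 ^ j ≤ 2 * K := by
  classical
  simp only [samples, hj, if_true]
  rcases le_or_gt K (2 ^ j) with h | h
  · left
    have := le_two_mul_div hK h
    nlinarith
  · exact Or.inr ⟨Nat.div_eq_of_lt h, by omega⟩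

theorem samples_global {j : ℕ} (hM : 0 < M) (hK : 0 < K) (hj : ¬ IsLocal M T j) :
    M * 2 ^ j ≤ 4 * K * samples M K T j ∨ samples M K T j = 0 ∧ M * 2 ^ j ≤ 2 * K := by
  classical
  simp only [samples, hj, if_false]
  rcases le_or_gt M K with h | h
  -- Rounding the number of arms per agent up costs at most a factor 2, and dropping the incomplete
  -- last round another factor 2.
  · have ha : M * groupArms M K ≤ 2 * K := by
      simp only [groupArms, groups, min_eq_left h]
      have := Nat.mul_div_le (K - 1) M
      rw [mul_add]
      omega
    rw [groupSize_eq_one hM h]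
    rcases le_or_gt (groupArms M K) (2 ^ j) with h' | h'
    · left
      have := le_two_mul_div groupArms_pos h'
      calc M * 2 ^ j ≤ M * (2 * groupArms M K * (2 ^ j / groupArms M K)) :=
            Nat.mul_le_mul_left _ this
        _ = 2 * (M * groupArms M K) * (2 ^ j / groupArms M K) := by ring
        _ ≤ 2 * (2 * K) * (2 ^ j / groupArms M K) := by gcongr
        _ = 4 * K * (1 * (2 ^ j / groupArms M K)) := by ring
    · right
      refine ⟨by simp [Nat.div_eq_of_lt h'], ?_⟩
      exact (Nat.mul_le_mul_left _ h'.le).trans ha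
  · left
    have ha : groupArms M K = 1 := by
      simp only [groupArms, groups, min_eq_right h.le]
      rw [Nat.div_eq_of_lt (by omega)]
    have := le_two_mul_div hK h.le
    simp only [groupSize, groups_eq_of_lt h, ha, Nat.div_one]
    calc M * 2 ^ j ≤ (2 * K * (M / K)) * 2 ^ j := by gcongr
      _ ≤ 4 * K * (M / K * 2 ^ j) := by
        have : 0 ≤ K * (M / K) * 2 ^ j := Nat.zero_le _
        nlinarith

end

/-! ### Concentration of the reward table -/

open ProbabilityTheory in
/-- Hoeffding's inequality for the coordinates of a product measure on a cube. -/
theorem measureReal_sum_gt_le {ι : Type*} [Fintype ι] (ρ : ι → Measure I)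
    [∀ e, IsProbabilityMeasure (ρ e)] (s : Finset ι) (L : ℝ) (hL : 0 ≤ L) :
    (Measure.pi ρ).real {x | √(3 * s.card * L) < |∑ e ∈ s, ((x e : ℝ) - ∫ y : I, (y : ℝ) ∂ρ e)|}
      ≤ 2 * Real.exp (-(6 * L)) := by
  classical
  rcases s.eq_empty_or_nonempty with rfl | hs
  · simp
    positivity
  set ε := √(3 * s.card * L) with hε
  set X : ι → (ι → I) → ℝ := fun e x => (x e : ℝ) - ∫ y : I, (y : ℝ) ∂ρ e with hX
  have hsub : ∀ e, HasSubgaussianMGF (X e) ((‖(1 : ℝ) - 0‖₊ / 2) ^ 2) (Measure.pi ρ) := by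
    intro e
    have h0 : HasSubgaussianMGF (fun y : I => (y : ℝ) - ∫ y : I, (y : ℝ) ∂ρ e)
        ((‖(1 : ℝ) - 0‖₊ / 2) ^ 2) (ρ e) :=
      hasSubgaussianMGF_of_mem_Icc (measurable_subtype_coe.aemeasurable)
        (Filter.Eventually.of_forall fun y => y.2)
    have hmp := measurePreserving_eval ρ e
    have h1 : HasSubgaussianMGF (fun y : I => (y : ℝ) - ∫ y : I, (y : ℝ) ∂ρ e)
        ((‖(1 : ℝ) - 0‖₊ / 2) ^ 2) ((Measure.pi ρ).map (Function.eval e)) := by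
      rw [hmp.map_eq]
      exact h0
    exact HasSubgaussianMGF.of_map (Y := Function.eval e) hmp.measurable.aemeasurable h1
  have hind : iIndepFun X (Measure.pi ρ) :=
    iIndepFun_pi (X := fun e (y : I) => (y : ℝ) - ∫ y : I, (y : ℝ) ∂ρ e)
      fun e => (measurable_subtype_coe.sub_const _).aemeasurable
  have hindneg : iIndepFun (fun e => -X e) (Measure.pi ρ) :=
    hind.comp (fun _ y => -y) fun _ => measurable_neg
  have hn : (0 : ℝ) < s.card := by exact_mod_cast hs.card_pos
  -- A variable in `[0, 1]` has variance proxy 1/4, so the exponent is `-2 ε ^ 2 / n` with `ε ^ 2 =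
  -- 3 n L`.
  have hexp : -ε ^ 2 / (2 * ((∑ _e ∈ s, ((‖(1 : ℝ) - 0‖₊ / 2) ^ 2 : NNReal) : NNReal) : ℝ))
      = -(6 * L) := by
    rw [hε, Real.sq_sqrt (by positivity)]
    simp
    field_simp
    ring
  have h1 := HasSubgaussianMGF.measure_sum_ge_le_of_iIndepFun hind (s := s) (fun e _ => hsub e)
    (Real.sqrt_nonneg _ : 0 ≤ ε)
  have h2 := HasSubgaussianMGF.measure_sum_ge_le_of_iIndepFun hindneg (s := s) (fun e _ => (hsub e).neg)
    (Real.sqrt_nonneg _ : 0 ≤ ε)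
  push_cast at hexp
  push_cast at h1 h2
  rw [hexp] at h1 h2
  have hsubset : {x | ε < |∑ e ∈ s, X e x|} ⊆
      {x | ε ≤ ∑ e ∈ s, X e x} ∪ {x | ε ≤ ∑ e ∈ s, (-X e) x} := by
    intro x hx
    rcases lt_abs.1 (show ε < |∑ e ∈ s, X e x| from hx) with h | h
    · exact Or.inl h.le
    · refine Or.inr ?_
      simp only [Set.mem_ofPred_eq, Pi.neg_apply, Finset.sum_neg_distrib]
      exact h.le
  calc _ ≤ (Measure.pi ρ).real
        ({x | ε ≤ ∑ e ∈ s, X e x} ∪ {x | ε ≤ ∑ e ∈ s, (-X e) x}) := measureReal_mono hsubset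
    _ ≤ _ := measureReal_union_le _ _
    _ ≤ _ := by linarith

/-- All empirical sums of the reward table that the algorithm may look at are accurate. -/
def Accurate {M K T : ℕ} (ν : Bandit K) (x : Fin T × Fin M × Fin K → I) : Prop :=
  ∀ (j : Fin T) (o : Option (Fin M)) (k : Fin K),
    |∑ e ∈ sampled M K T j o k, ((x e : ℝ) - ν.mean e.2.2)|
      ≤ √(3 * (sampled M K T j o k).card * Real.log T)

theorem measurableSet_accurate {M K T : ℕ} (ν : Bandit K) :
    MeasurableSet {x : Fin T × Fin M × Fin K → I | Accurate ν x} := by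
  simp only [Accurate, Set.ofPred_forall]
  refine MeasurableSet.iInter fun j => MeasurableSet.iInter fun o => MeasurableSet.iInter fun k =>
    measurableSet_le ?_ measurable_const
  refine (Finset.measurable_sum _ fun e _ => ?_).abs
  exact (measurable_subtype_coe.comp (measurable_pi_apply e)).sub_const _

/-- A union bound: there are at most `T ^ 3` triples, and each fails with probability at most `2 / T
^ 6`. Since the sets `sampled` are fixed in advance, no adaptivity enters. -/
theorem measureReal_not_accurate_le {M K T : ℕ} (hMT : M < T) (hKT : K < T) (hT : 2 < T)
    (ν : Bandit K) :
    (Measure.pi fun e : Fin T × Fin M × Fin K => (ν e.2.2 : Measure I)).real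
      {x | ¬ Accurate ν x} ≤ 1 / T := by
  have hT0 : (0 : ℝ) < T := by positivity
  have hlog : 0 ≤ Real.log T := Real.log_natCast_nonneg T
  have hset : {x : Fin T × Fin M × Fin K → I | ¬ Accurate ν x} =
      ⋃ p ∈ (Finset.univ : Finset (Fin T × Option (Fin M) × Fin K)),
        {x | √(3 * (sampled M K T p.1 p.2.1 p.2.2).card * Real.log T) <
          |∑ e ∈ sampled M K T p.1 p.2.1 p.2.2,
            ((x e : ℝ) - ∫ y : I, (y : ℝ) ∂(ν e.2.2 : Measure I))|} := by
    ext x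
    simp [Accurate, Bandit.mean]
  rw [hset]
  refine (measureReal_biUnion_finset_le _ _).trans ?_
  refine (Finset.sum_le_sum fun p _ => measureReal_sum_gt_le
    (fun e : Fin T × Fin M × Fin K => (ν e.2.2 : Measure I)) _ _ hlog).trans ?_
  have he : Real.exp (-(6 * Real.log T)) = 1 / (T : ℝ) ^ 6 := by
    rw [Real.exp_neg, mul_comm, Real.exp_mul, Real.exp_log hT0, one_div]
    norm_cast
  rw [Finset.sum_const, he, nsmul_eq_mul, Finset.card_univ]
  simp only [Fintype.card_prod, Fintype.card_fin, Fintype.card_option]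
  rw [mul_one_div, mul_div_assoc', div_le_div_iff₀ (by positivity) hT0]
  have h1 : ((T * ((M + 1) * K) : ℕ) : ℝ) ≤ T ^ 3 := by
    have : T * ((M + 1) * K) ≤ T ^ 3 := by
      calc T * ((M + 1) * K) ≤ T * (T * T) := by gcongr; omega
        _ = T ^ 3 := by ring
    exact_mod_cast this
  have h2 : (3 : ℝ) ≤ T := by exact_mod_cast hT
  calc ((T * ((M + 1) * K) : ℕ) : ℝ) * 2 * T ≤ T ^ 3 * T * T := by
        rw [mul_assoc, mul_assoc]
        gcongr
        linarith
    _ ≤ T ^ 3 * T * T * T := le_mul_of_one_le_right (by positivity) (by linarith)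
    _ = 1 * T ^ 6 := by ring

/-! ### The protocol -/

open Classical in
/-- An element of `S` with the largest value of `f` (and `0` if `S` is empty). -/
noncomputable def best {K : ℕ} [NeZero K] (S : Finset (Fin K)) (f : Fin K → ℕ) : Fin K :=
  if h : S.Nonempty then (S.exists_max_image f h).choose else 0

theorem best_mem {K : ℕ} [NeZero K] {S : Finset (Fin K)} (f : Fin K → ℕ) (h : S.Nonempty) :
    best S f ∈ S := by
  rw [best, dif_pos h]
  exact (S.exists_max_image f h).choose_spec.1

theorem le_best {K : ℕ} [NeZero K] {S : Finset (Fin K)} (f : Fin K → ℕ) {k : Fin K}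
    (h : k ∈ S) : f k ≤ f (best S f) := by
  rw [best, dif_pos ⟨k, h⟩]
  exact (S.exists_max_image f ⟨k, h⟩).choose_spec.2 k h

/-- Memory of an agent. -/
@[ext] structure Agent (K : ℕ) where
  /-- Number of past pulls. -/
  clock : ℕ
  /-- The arms that have not been eliminated. -/
  active : Finset (Fin K)
  /-- Sums of the rounded rewards sampled in the current epoch. -/
  sums : Fin K → ℕ
  /-- The arm to pull when no active arm is scheduled. -/
  fallback : Fin K

instance {K : ℕ} : MeasurableSpace (Agent K) := ⊤

instance {K : ℕ} : DiscreteMeasurableSpace (Agent K) := ⟨fun _ => trivial⟩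

instance {K : ℕ} : Countable (Agent K) :=
  Function.Injective.countable
    (f := fun s : Agent K => (s.clock, s.active, s.sums, s.fallback)) fun s t h => by
      simp only [Prod.mk.injEq] at h
      exact Agent.ext h.1 h.2.1 h.2.2.1 h.2.2.2

/-- The arm with the largest sum among the active arms. -/
noncomputable def Agent.top {K : ℕ} [NeZero K] (s : Agent K) : Fin K := best s.active s.sums

/-- An epoch has just ended when the clock shows `n`. -/
def Boundary (n : ℕ) : Prop := epoch (n - 1) ≠ epoch n

/-- A reward as a multiple of `1 / T`, rounded down. -/
noncomputable def quantize (T : ℕ) (x : I) : ℕ := ⌊(x : ℝ) * T⌋₊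

theorem quantize_le (T : ℕ) (x : I) : quantize T x ≤ T := by
  have : (x : ℝ) * T ≤ T := mul_le_of_le_one_left (by positivity) x.2.2
  exact Nat.floor_le_of_le this

theorem measurable_quantize (T : ℕ) : Measurable (quantize T) :=
  Nat.measurable_floor.comp (measurable_subtype_coe.mul_const _)

/-- Accuracy of the rounded sums of epoch `j`. -/
noncomputable def width (M K T j : ℕ) : ℝ :=
  T * √(3 * samples M K T j * Real.log T) + samples M K T j

/-- The entry of a message at a position. -/
def entry {q : ℕ} (l : Message q) (p : ℕ) : ℕ := (l[p]?.map Fin.val).getD 0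

section

variable (M K T : ℕ) [NeZero K] [NeZero T]

/-- A natural number as a packet. -/
def packet (v : ℕ) : Fin (T ^ 4) := Fin.ofNat (T ^ 4) v

open Classical in
/-- What an agent reports at the end of a global epoch: the best of its arms and its sum. -/
noncomputable def report (s : Agent K) : Message (T ^ 4) :=
  if Boundary s.clock ∧ ¬ IsLocal M T (epoch (s.clock - 1)) ∧ s.active.Nonempty then
    [packet T (s.top), packet T (s.sums (s.top))]
  else []

open Classical in
/-- The agents that report an arm. -/
noncomputable def reporters (msg : Fin M → Message (T ^ 4)) (k : Fin K) : Finset (Fin M) :=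
  Finset.univ.filter fun i => msg i ≠ [] ∧ entry (msg i) 0 = k

/-- The sum of the reported values of an arm. -/
noncomputable def total (msg : Fin M → Message (T ^ 4)) (k : Fin K) : ℕ :=
  ∑ i ∈ reporters M K T msg k, entry (msg i) 1

open Classical in
/-- The arms that are reported by all the agents that are in charge of them. -/
noncomputable def pooled (msg : Fin M → Message (T ^ 4)) : Finset (Fin K) :=
  Finset.univ.filter fun k => (reporters M K T msg k).card = groupSize M K

open Classical in
/-- The answer of the server: the best arm, its total, and the total of the reported arm. -/
noncomputable def answer (msg : Fin M → Message (T ^ 4)) (i : Fin M) : Message (T ^ 4) :=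
  if (pooled M K T msg).Nonempty then
    [packet T (best (pooled M K T msg) (total M K T msg)),
      packet T (total M K T msg (best (pooled M K T msg) (total M K T msg)))] ++
      if h : ∃ k ∈ pooled M K T msg, i ∈ reporters M K T msg k then
        [packet T (total M K T msg h.choose)] else []
  else []

open Classical in
/-- What an agent does at the end of a local epoch. -/
noncomputable def localUpdate (i : Fin M) (s : Agent K) : Agent K where
  clock := s.clock
  active := s.active.filter fun k =>
    (s.sums (s.top) : ℝ) ≤ s.sums k + 2 * width M K T (epoch (s.clock - 1)) ∧
      (IsLocal M T (epoch s.clock) ∨ Owns M K i k)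
  sums := 0
  fallback := s.top

open Classical in
/-- What an agent does at the end of a global epoch. -/
noncomputable def globalUpdate (s : Agent K) (msg : Message (T ^ 4)) : Agent K where
  clock := s.clock
  active := s.active.filter fun k =>
    if k = s.top then
      2 < msg.length ∧
        (entry msg 1 : ℝ) ≤ entry msg 2 + 2 * width M K T (epoch (s.clock - 1))
    else (entry msg 1 : ℝ) ≤ s.sums k + 2 * width M K T (epoch (s.clock - 1))
  sums := 0
  fallback := Fin.ofNat K (entry msg 0)

open Classical in
/-- What an agent does in a communication round. -/
noncomputable def update (i : Fin M) (s : Agent K) (msg : Message (T ^ 4)) : Agent K :=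
  if Boundary s.clock then
    if IsLocal M T (epoch (s.clock - 1)) then localUpdate M K T i s else globalUpdate M K T s msg
  else s

open Classical in
/-- The arm that an agent pulls. -/
noncomputable def choice (i : Fin M) (s : Agent K) : Fin K :=
  if h : ∃ k ∈ s.active, IsSlot M K T s.clock i k then h.choose else s.fallback

open Classical in
/-- What an agent does after a pull whose rounded reward is `y`. -/
noncomputable def record (i : Fin M) (s : Agent K) (y : ℕ) : Agent K where
  clock := s.clock + 1
  active := s.active
  sums := fun k => s.sums k + if k ∈ s.active ∧ IsSlot M K T s.clock i k then y else 0
  fallback := s.fallback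

/-- Distributed elimination. -/
noncomputable def protocol : Protocol M K 1 (T ^ 4) where
  Seed := Unit
  AgentState := Agent K
  ServerState := Fin M → Message (T ^ 4)
  serverMeas := ⊤
  agentSeed _ := ⟨Measure.dirac (), inferInstance⟩
  serverSeed := ⟨Measure.dirac (), inferInstance⟩
  agentInit _ _ := ⟨0, Finset.univ, 0, 0⟩
  serverInit _ := fun _ => []
  agentSend _ := report M K T
  serverRecv _ msg := msg
  serverSend := answer M K T
  agentRecv := update M K T
  arm := choice M K T
  observe i s x := record M K T i s (quantize T x)
  measurable_agentInit _ := measurable_const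
  measurable_serverInit := measurable_const
  measurable_agentSend _ := fun _ _ => MeasurableSpace.measurableSet_top
  measurable_serverRecv _ := fun _ _ => MeasurableSpace.measurableSet_top
  measurable_serverSend _ := fun _ _ => MeasurableSpace.measurableSet_top
  measurable_agentRecv _ _ := fun _ _ => MeasurableSpace.measurableSet_top
  measurable_arm _ := fun _ _ => MeasurableSpace.measurableSet_top
  measurable_observe i := by
    have h : Measurable fun p : Agent K × ℕ => record M K T i p.1 p.2 := Measurable.of_discrete
    exact h.comp (measurable_fst.prodMk ((measurable_quantize T).comp measurable_snd))

end

theorem val_packet {T : ℕ} [NeZero T] {v : ℕ} (h : v < T ^ 4) : (packet T v : ℕ) = v :=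
  Nat.mod_eq_of_lt h

theorem choice_eq {M K T : ℕ} [NeZero K] {i : Fin M} {s : Agent K} {k : Fin K}
    (hk : k ∈ s.active) (h : IsSlot M K T s.clock i k) : choice M K T i s = k := by
  have hex : ∃ k ∈ s.active, IsSlot M K T s.clock i k := ⟨k, hk, h⟩
  rw [choice, dif_pos hex]
  exact Fin.ext (isSlot_unique hex.choose_spec.2 h)

theorem choice_mem {M K T : ℕ} [NeZero K] (i : Fin M) (s : Agent K) :
    choice M K T i s ∈ s.active ∨ choice M K T i s = s.fallback := by
  rw [choice]
  split_ifs with hex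
  · exact Or.inl hex.choose_spec.1
  · exact Or.inr rfl

/-! ### One round of global elimination -/

section Round

variable {M K T : ℕ}

/-- The situation at the end of a global epoch: agent `i` has collected `E i k` for arm `k`. -/
structure Collected (M K T : ℕ) (s : Fin M → Agent K) (E : Fin M → Fin K → ℕ) : Prop where
  boundary : ∀ i, Boundary (s i).clock
  not_local : ∀ i, ¬ IsLocal M T (epoch ((s i).clock - 1))
  owns : ∀ i, ∀ k ∈ (s i).active, Owns M K i k
  sums : ∀ i, ∀ k ∈ (s i).active, (s i).sums k = E i k
  eq_zero : ∀ (i : Fin M) (k : Fin K), ¬ Owns M K i k → E i k = 0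
  le : ∀ i k, E i k ≤ T * T
  lt_horizon : M < T
  arms_lt : K < T

namespace Collected

variable {s : Fin M → Agent K} {E : Fin M → Fin K → ℕ}

theorem sum_eq_of_le (h : Collected M K T s E) (hMK : M ≤ K) {i : Fin M} {k : Fin K}
    (hi : Owns M K i k) : ∑ i', E i' k = E i k := by
  refine Finset.sum_eq_single i (fun i' _ hne => h.eq_zero i' k fun hi' => hne ?_) (by simp)
  exact Owns.agent_eq i.pos hMK hi' hi

variable [NeZero K]

theorem top_mem {i : Fin M} (hi : (s i).active.Nonempty) : (s i).top ∈ (s i).active :=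
  best_mem _ hi

/-- A total of `M` sums, each at most `T * T`, stays below `T ^ 3`; this is why packets of size `T ^
4` carry it without wrapping around. -/
theorem lt_pow (h : Collected M K T s E) {v : ℕ} (hv : v ≤ T ^ 3) : v < T ^ 4 := by
  have := h.lt_horizon
  have hT : 1 < T ∨ M = 0 := by omega
  have := h.arms_lt
  have := NeZero.pos K
  exact hv.trans_lt (Nat.pow_lt_pow_right (by omega) (by norm_num))

theorem arm_lt_pow (h : Collected M K T s E) (k : Fin K) : (k : ℕ) < T ^ 4 :=
  h.lt_pow ((k.2.le.trans h.arms_lt.le).trans (Nat.le_self_pow (by norm_num) T))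

theorem sum_lt (h : Collected M K T s E) (k : Fin K) : ∑ i, E i k < T ^ 4 := by
  refine h.lt_pow ?_
  calc ∑ i, E i k ≤ ∑ _i : Fin M, T * T := Finset.sum_le_sum fun i _ => h.le i k
    _ = M * (T * T) := by simp
    _ ≤ T * (T * T) := Nat.mul_le_mul_right _ h.lt_horizon.le
    _ = T ^ 3 := by ring

/-- An agent with a second active arm can exist only if `M ≤ K`, and then it is the only owner of
its arms. This justifies comparing local sums with the global maximum in `globalUpdate`. -/
theorem sum_eq_of_ne_top (h : Collected M K T s E) {i : Fin M} {k : Fin K}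
    (hk : k ∈ (s i).active) (hne : k ≠ (s i).top) : ∑ i', E i' k = (s i).sums k := by
  have hMK : M ≤ K := by
    by_contra hc
    exact hne (Fin.ext (Owns.arm_eq (not_le.1 hc) k.2 (s i).top.2 (h.owns i k hk)
      (h.owns i _ (top_mem ⟨k, hk⟩))))
  rw [h.sum_eq_of_le hMK (h.owns i k hk), h.sums i k hk]

theorem sum_le_sum_top (h : Collected M K T s E) {i : Fin M} {k : Fin K}
    (hk : k ∈ (s i).active) : ∑ i', E i' k ≤ ∑ i', E i' (s i).top := by
  by_cases hne : k = (s i).top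
  · rw [← hne]
  · have hMK : M ≤ K := by
      by_contra hc
      exact hne (Fin.ext (Owns.arm_eq (not_le.1 hc) k.2 (s i).top.2 (h.owns i k hk)
        (h.owns i _ (top_mem ⟨k, hk⟩))))
    rw [h.sum_eq_of_le hMK (h.owns i k hk), h.sum_eq_of_le hMK (h.owns i _ (top_mem ⟨k, hk⟩)),
      ← h.sums i k hk, ← h.sums i _ (top_mem ⟨k, hk⟩)]
    exact le_best _ hk

variable [NeZero T]

theorem report_eq (h : Collected M K T s E) {i : Fin M} (hi : (s i).active.Nonempty) :
    report M K T (s i) = [packet T (s i).top, packet T (E i (s i).top)] := by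
  rw [report, if_pos ⟨h.boundary i, h.not_local i, hi⟩, ← h.sums i _ (top_mem hi)]

theorem report_eq_nil {i : Fin M} (hi : ¬ (s i).active.Nonempty) :
    report M K T (s i) = [] := by
  rw [report, if_neg (by tauto)]

theorem mem_reporters (h : Collected M K T s E) {i : Fin M} {k : Fin K} :
    i ∈ reporters M K T (fun i => report M K T (s i)) k ↔
      (s i).active.Nonempty ∧ (s i).top = k := by
  classical
  simp only [reporters, Finset.mem_filter, Finset.mem_univ, true_and]
  by_cases hi : (s i).active.Nonempty
  · simp [h.report_eq hi, hi, entry, val_packet (h.arm_lt_pow _), Fin.ext_iff]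
  · simp [report_eq_nil hi, hi]

theorem entry_one (h : Collected M K T s E) {i : Fin M} (hi : (s i).active.Nonempty) :
    entry (report M K T (s i)) 1 = E i (s i).top := by
  simp only [h.report_eq hi, entry]
  have : E i (s i).top < T ^ 4 :=
    h.lt_pow ((h.le _ _).trans (by rw [← sq]; exact Nat.pow_le_pow_right (NeZero.pos T) (by norm_num)))
  simp [val_packet this]

theorem owns_of_mem_reporters (h : Collected M K T s E) {i : Fin M} {k : Fin K}
    (hi : i ∈ reporters M K T (fun i => report M K T (s i)) k) : Owns M K i k := by
  obtain ⟨hne, rfl⟩ := h.mem_reporters.1 hi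
  exact h.owns _ _ (top_mem hne)

-- Only owners can report an arm, so counting the reports decides whether all owners have done so.
open Classical in
theorem mem_pooled (h : Collected M K T s E) (hM : 0 < M) {k : Fin K} :
    k ∈ pooled M K T (fun i => report M K T (s i)) ↔
      reporters M K T (fun i => report M K T (s i)) k =
        Finset.univ.filter fun i : Fin M => Owns M K i k := by
  simp only [pooled, Finset.mem_filter, Finset.mem_univ, true_and]
  constructor
  · intro hk
    refine Finset.eq_of_subset_of_card_le (fun i hi => ?_) ?_
    · simpa using h.owns_of_mem_reporters hi
    · rw [card_owners hM, hk]
  · intro hk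
    rw [hk, card_owners hM]

theorem total_eq (h : Collected M K T s E) (hM : 0 < M) {k : Fin K}
    (hk : k ∈ pooled M K T (fun i => report M K T (s i))) :
    total M K T (fun i => report M K T (s i)) k = ∑ i, E i k := by
  classical
  rw [total]
  have : ∀ i ∈ reporters M K T (fun i => report M K T (s i)) k,
      entry (report M K T (s i)) 1 = E i k := by
    intro i hi
    obtain ⟨hne, rfl⟩ := h.mem_reporters.1 hi
    exact h.entry_one hne
  rw [Finset.sum_congr rfl this, (h.mem_pooled hM).1 hk, Finset.sum_filter]
  refine Finset.sum_congr rfl fun i _ => ?_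
  split_ifs with ho
  · rfl
  · exact (h.eq_zero i k ho).symm

/-- The reported arm of an owner of an arm that no owner has eliminated is pooled. -/
theorem top_mem_pooled (h : Collected M K T s E) {b : Fin K}
    (hb : ∀ i : Fin M, Owns M K i b → b ∈ (s i).active) {i : Fin M} (hi : Owns M K i b) :
    (s i).top ∈ pooled M K T (fun i => report M K T (s i)) := by
  classical
  rw [h.mem_pooled i.pos]
  have hne : (s i).active.Nonempty := ⟨b, hb i hi⟩
  refine Finset.Subset.antisymm
    (fun i' hi' => by simpa using h.owns_of_mem_reporters hi') fun i' hi' => ?_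
  replace hi' : Owns M K i' (s i).top := by simpa using hi'
  -- With a single owner its report is enough. Otherwise the top arm is `b`, the only arm of each of
  -- its owners, and all of them have kept it.
  rcases le_or_gt M K with hMK | hKM
  · obtain rfl := Owns.agent_eq i.pos hMK hi' (h.owns i _ (top_mem hne))
    exact h.mem_reporters.2 ⟨hne, rfl⟩
  · have hb1 : (s i).top = b := Fin.ext (Owns.arm_eq hKM (s i).top.2 b.2
      (h.owns i _ (top_mem hne)) hi)
    rw [hb1] at hi' ⊢
    have hne' : (s i').active.Nonempty := ⟨b, hb i' hi'⟩
    exact h.mem_reporters.2 ⟨hne', Fin.ext (Owns.arm_eq hKM (s i').top.2 b.2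
      (h.owns i' _ (top_mem hne')) hi')⟩

/-- The arm that the server declares to be the best one. -/
noncomputable def leader (M : ℕ) (T : ℕ) [NeZero T] (s : Fin M → Agent K) : Fin K :=
  best (pooled M K T fun i => report M K T (s i)) (total M K T fun i => report M K T (s i))

/-- What agent `i` receives from the server. -/
noncomputable def reply (M : ℕ) (T : ℕ) [NeZero T] (s : Fin M → Agent K) (i : Fin M) :
    Message (T ^ 4) :=
  answer M K T (fun i => report M K T (s i)) i

theorem reply_eq (h : Collected M K T s E)
    (hp : (pooled M K T fun i => report M K T (s i)).Nonempty) {i : Fin M}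
    (hi : (s i).active.Nonempty) (hi' : (s i).top ∈ pooled M K T fun i => report M K T (s i)) :
    reply M T s i = [packet T (leader M T s), packet T (∑ i', E i' (leader M T s)),
      packet T (∑ i', E i' (s i).top)] := by
  have hex : ∃ k ∈ pooled M K T (fun i => report M K T (s i)),
      i ∈ reporters M K T (fun i => report M K T (s i)) k :=
    ⟨_, hi', h.mem_reporters.2 ⟨hi, rfl⟩⟩
  have htop : hex.choose = (s i).top := (h.mem_reporters.1 hex.choose_spec.2).2.symm
  have hl : leader M T s ∈ pooled M K T fun i => report M K T (s i) := best_mem _ hp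
  rw [reply, answer, if_pos hp, dif_pos hex, htop, h.total_eq i.pos hi', ← leader,
    h.total_eq i.pos hl]
  rfl

theorem reply_eq_of_not (h : Collected M K T s E)
    (hp : (pooled M K T fun i => report M K T (s i)).Nonempty) {i : Fin M}
    (hi' : ¬ ((s i).active.Nonempty ∧ (s i).top ∈ pooled M K T fun i => report M K T (s i))) :
    reply M T s i = [packet T (leader M T s), packet T (∑ i', E i' (leader M T s))] := by
  have hex : ¬ ∃ k ∈ pooled M K T (fun i => report M K T (s i)),
      i ∈ reporters M K T (fun i => report M K T (s i)) k := by
    rintro ⟨k, hk, hik⟩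
    obtain ⟨h1, rfl⟩ := h.mem_reporters.1 hik
    exact hi' ⟨h1, hk⟩
  have hl : leader M T s ∈ pooled M K T fun i => report M K T (s i) := best_mem _ hp
  rw [reply, answer, if_pos hp, dif_neg hex, ← leader, h.total_eq i.pos hl]
  rfl

theorem entries_reply (h : Collected M K T s E)
    (hp : (pooled M K T fun i => report M K T (s i)).Nonempty) (i : Fin M) :
    entry (reply M T s i) 0 = leader M T s ∧
      entry (reply M T s i) 1 = ∑ i', E i' (leader M T s) := by
  by_cases hc : (s i).active.Nonempty ∧ (s i).top ∈ pooled M K T fun i => report M K T (s i)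
  · rw [h.reply_eq hp hc.1 hc.2]
    simp [entry, val_packet (h.arm_lt_pow _), val_packet (h.sum_lt _)]
  · rw [h.reply_eq_of_not hp hc]
    simp [entry, val_packet (h.arm_lt_pow _), val_packet (h.sum_lt _)]

theorem fallback_globalUpdate (h : Collected M K T s E)
    (hp : (pooled M K T fun i => report M K T (s i)).Nonempty) (i : Fin M) :
    (globalUpdate M K T (s i) (reply M T s i)).fallback = leader M T s := by
  simp only [globalUpdate, (h.entries_reply hp i).1]
  exact Fin.ext (Nat.mod_eq_of_lt (leader M T s).2)

/-- An arm that survives a global epoch has a large total. -/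
theorem of_mem_globalUpdate (h : Collected M K T s E)
    (hp : (pooled M K T fun i => report M K T (s i)).Nonempty) {i : Fin M} {k : Fin K}
    (hk : k ∈ (globalUpdate M K T (s i) (reply M T s i)).active) :
    k ∈ (s i).active ∧ ((∑ i', E i' (leader M T s) : ℕ) : ℝ) ≤
      ((∑ i', E i' k : ℕ) : ℝ) + 2 * width M K T (epoch ((s i).clock - 1)) := by
  simp only [globalUpdate, Finset.mem_filter] at hk
  obtain ⟨hk, hw⟩ := hk
  refine ⟨hk, ?_⟩
  have hne : (s i).active.Nonempty := ⟨k, hk⟩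
  rw [(h.entries_reply hp i).2] at hw
  by_cases hkt : k = (s i).top
  · rw [if_pos hkt] at hw
    by_cases hc : (s i).top ∈ pooled M K T fun i => report M K T (s i)
    · rw [h.reply_eq hp hne hc] at hw
      have := hw.2
      simp only [entry, List.getElem?_cons_succ, List.getElem?_cons_zero, Option.map_some,
        Option.getD_some, val_packet (h.sum_lt _)] at this
      rwa [hkt]
    -- An unconfirmed top arm gets an answer of only two packets, so the length test drops it.
    · rw [h.reply_eq_of_not hp (by tauto)] at hw
      simp at hw
  · rw [if_neg hkt] at hw
    rwa [h.sum_eq_of_ne_top hk hkt]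

/-- An arm with a large total survives a global epoch. -/
theorem mem_globalUpdate (h : Collected M K T s E) {b : Fin K}
    (hb : ∀ i : Fin M, Owns M K i b → b ∈ (s i).active) {i : Fin M} (hi : Owns M K i b)
    (hw : ((∑ i', E i' (leader M T s) : ℕ) : ℝ) ≤
      ((∑ i', E i' b : ℕ) : ℝ) + 2 * width M K T (epoch ((s i).clock - 1))) :
    b ∈ (globalUpdate M K T (s i) (reply M T s i)).active := by
  have hc := h.top_mem_pooled hb hi
  have hp : (pooled M K T fun i => report M K T (s i)).Nonempty := ⟨_, hc⟩
  have hne : (s i).active.Nonempty := ⟨b, hb i hi⟩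
  simp only [globalUpdate, Finset.mem_filter]
  refine ⟨hb i hi, ?_⟩
  rw [(h.entries_reply hp i).2]
  by_cases hkt : b = (s i).top
  · rw [if_pos hkt, h.reply_eq hp hne hc]
    simp only [entry, List.getElem?_cons_succ, List.getElem?_cons_zero, Option.map_some,
        Option.getD_some, val_packet (h.sum_lt _)]
    rw [← hkt]
    exact ⟨by simp, hw⟩
  · rw [if_neg hkt, ← h.sum_eq_of_ne_top (hb i hi) hkt]
    exact hw

/-- The leader has at least the total of an arm that no owner has eliminated. -/
theorem sum_le_sum_leader (h : Collected M K T s E) {b : Fin K}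
    (hb : ∀ i : Fin M, Owns M K i b → b ∈ (s i).active) {i : Fin M} (hi : Owns M K i b) :
    ∑ i', E i' b ≤ ∑ i', E i' (leader M T s) := by
  have hc := h.top_mem_pooled hb hi
  have hl : leader M T s ∈ pooled M K T fun i => report M K T (s i) := best_mem _ ⟨_, hc⟩
  refine (h.sum_le_sum_top (hb i hi)).trans ?_
  rw [← h.total_eq i.pos hc, ← h.total_eq i.pos hl]
  exact le_best _ hc

end Collected

end Round

/-! ### From accurate sums to bounds for gaps -/

/-- Accuracy of the estimates that follow from `D` samples shared by `K` arms. -/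
noncomputable def radius (M K T j : ℕ) : ℝ :=
  18 * √(K * Real.log T / ((M * 2 ^ j : ℕ) : ℝ))

theorem one_le_log {T : ℕ} (ht : 2 < T) : 1 ≤ Real.log T := by
  rw [Real.le_log_iff_exp_le (by positivity)]
  have : (3 : ℝ) ≤ T := by exact_mod_cast ht
  linarith [Real.exp_one_lt_d9]

/-- Here `t` is the scale of the rounding, `N` the number of samples of an arm, and `D` the number
of pulls shared by `k` arms. As `N` is at least `D / (4 k)`, the deviation per sample is of order
`√(k L / D)`. -/
theorem gap_le_radius {g t N k L D : ℝ} (hg : g ≤ 1) (ht : 0 < t) (hk : 1 ≤ k) (hL : 1 ≤ L)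
    (hD : 0 < D) (hDt : D ≤ t * t) (hN : 0 ≤ N) (hND : D ≤ 4 * k * N ∨ N = 0 ∧ D ≤ 2 * k)
    (h : t * N * g ≤ 4 * (t * √(3 * N * L) + N)) : g ≤ 18 * √(k * L / D) := by
  set r := √(k * L / D) with hr
  have hr0 : 0 ≤ r := Real.sqrt_nonneg _
  have hkL : 1 ≤ k * L := one_le_mul_of_one_le_of_one_le hk hL
  have hr2 : r ^ 2 * D = k * L := by
    rw [hr, Real.sq_sqrt (by positivity)]
    field_simp
  rcases hND with hND | ⟨-, hND⟩
  · have hN0 : 0 < N := by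
      by_contra hc
      have : N = 0 := by linarith
      rw [this] at hND
      linarith
    have hL4 : L ≤ 4 * N * r ^ 2 := by
      have h1 : k * L ≤ r ^ 2 * (4 * k * N) := by
        rw [← hr2]
        gcongr
      have h2 : k * L ≤ k * (4 * N * r ^ 2) := by linarith
      exact le_of_mul_le_mul_left h2 (by linarith)
    -- This uses `√12 ≤ 7 / 2`.
    have hsq : √(3 * N * L) ≤ 7 / 2 * N * r := by
      rw [Real.sqrt_le_left (by positivity)]
      nlinarith [mul_le_mul_of_nonneg_left hL4 hN0.le, sq_nonneg (N * r)]
    -- Since `D ≤ t * t`, the rounding error `N` is at most `N * (t * r)`; the constant is then `18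
    -- = 4 * (7 / 2 + 1)`.
    have htr : 1 ≤ t * r := by
      have h1 : 1 ≤ (t * r) ^ 2 := by
        have : r ^ 2 * D ≤ r ^ 2 * (t * t) := by gcongr
        nlinarith
      exact (one_le_sq_iff₀ (by positivity)).1 h1
    have h3 : t * N * g ≤ t * N * (18 * r) := by
      calc t * N * g ≤ 4 * (t * √(3 * N * L) + N) := h
        _ ≤ 4 * (t * (7 / 2 * N * r) + N * (t * r)) := by
          gcongr
          exact le_mul_of_one_le_right hN htr
        _ = t * N * (18 * r) := by ring
    exact le_of_mul_le_mul_left h3 (by positivity)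
  -- Without samples, `D ≤ 2 * k` makes the claimed bound exceed 1.
  · have h1 : 1 / 18 ≤ r := by
      refine Real.le_sqrt_of_sq_le ?_
      rw [le_div_iff₀ hD]
      nlinarith
    linarith

section

variable {M K T : ℕ}

open Classical in
/-- Rounded rewards that are sampled by agent `i` for arm `k` in epoch `j` before time `n`. -/
noncomputable def collected (x : Fin T × Fin M × Fin K → I) (j n : ℕ) (i : Fin M) (k : Fin K) :
    ℕ :=
  ∑ t : Fin T, if (t : ℕ) < n ∧ epoch t = j ∧ IsSlot M K T t i k then quantize T (x (t, i, k))
    else 0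

theorem collected_le (x : Fin T × Fin M × Fin K → I) (j n : ℕ) (i : Fin M) (k : Fin K) :
    collected x j n i k ≤ T * T := by
  classical
  calc collected x j n i k ≤ ∑ _t : Fin T, T := Finset.sum_le_sum fun t _ => by
        split_ifs
        exacts [quantize_le _ _, Nat.zero_le _]
    _ = T * T := by simp

theorem collected_eq_zero (x : Fin T × Fin M × Fin K → I) {j n : ℕ} (hn : n + 1 ≤ 2 ^ j)
    (i : Fin M) (k : Fin K) : collected x j n i k = 0 := by
  classical
  refine Finset.sum_eq_zero fun t _ => if_neg ?_
  rintro ⟨h1, rfl, -⟩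
  have := two_pow_epoch_le (t : ℕ)
  omega

theorem collected_eq_zero_of_not_owns (x : Fin T × Fin M × Fin K → I) {j n : ℕ}
    (hj : ¬ IsLocal M T j) {i : Fin M} {k : Fin K} (h : ¬ Owns M K i k) :
    collected x j n i k = 0 := by
  classical
  refine Finset.sum_eq_zero fun t _ => if_neg ?_
  rintro ⟨-, rfl, h3⟩
  rw [IsSlot, if_neg hj] at h3
  exact h h3.1

open Classical in
theorem collected_succ (x : Fin T × Fin M × Fin K → I) {n : ℕ} (h : n < T) (i : Fin M)
    (k : Fin K) :
    collected x (epoch n) (n + 1) i k = collected x (epoch n) n i k +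
      if IsSlot M K T n i k then quantize T (x (⟨n, h⟩, i, k)) else 0 := by
  have : ∀ t : Fin T,
      (if (t : ℕ) < n + 1 ∧ epoch t = epoch n ∧ IsSlot M K T t i k then
        quantize T (x (t, i, k)) else 0) =
      (if (t : ℕ) < n ∧ epoch t = epoch n ∧ IsSlot M K T t i k then
        quantize T (x (t, i, k)) else 0) +
      (if t = ⟨n, h⟩ then (if IsSlot M K T n i k then quantize T (x (⟨n, h⟩, i, k)) else 0)
        else 0) := by
    intro t
    by_cases ht : t = ⟨n, h⟩
    · subst ht
      simp
    · have : (t : ℕ) ≠ n := fun hc => ht (Fin.ext hc)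
      have : (t : ℕ) < n + 1 ↔ (t : ℕ) < n := by omega
      simp [ht, this]
  rw [collected, Finset.sum_congr rfl fun t _ => this t, Finset.sum_add_distrib]
  simp [collected]

/-- The hypothesis on `n` says that epoch `j` is over, so the cut-off at time `n` removes nothing.
-/
theorem sum_sampled_some (x : Fin T × Fin M × Fin K → I) {j n : ℕ} (hn : 2 ^ (j + 1) ≤ n + 1)
    (i : Fin M) (k : Fin K) :
    ∑ e ∈ sampled M K T j (some i) k, quantize T (x e) = collected x j n i k := by
  classical
  rw [sampled, Finset.sum_filter, Fintype.sum_prod_type, collected]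
  refine Finset.sum_congr rfl fun t _ => ?_
  rw [Fintype.sum_prod_type, Finset.sum_eq_single i, Finset.sum_eq_single k]
  · have : epoch t = j → (t : ℕ) < n := by
      rintro rfl
      have := lt_two_pow_epoch (t : ℕ)
      omega
    by_cases h1 : epoch t = j
    · simp [h1, this h1]
    · simp [h1]
  · intro k' _ hk'
    simp [hk']
  · simp
  · intro i' _ hi'
    refine Finset.sum_eq_zero fun k' _ => if_neg ?_
    rintro ⟨h, -⟩
    exact hi' (h i rfl)
  · simp

theorem sum_sampled_none (x : Fin T × Fin M × Fin K → I) {j n : ℕ} (hn : 2 ^ (j + 1) ≤ n + 1)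
    (k : Fin K) :
    ∑ e ∈ sampled M K T j none k, quantize T (x e) = ∑ i, collected x j n i k := by
  classical
  rw [← Finset.sum_fiberwise (sampled M K T j none k) (fun e => e.2.1)]
  refine Finset.sum_congr rfl fun i _ => ?_
  rw [← sum_sampled_some x hn i k]
  refine Finset.sum_congr ?_ fun _ _ => rfl
  ext e
  simp only [sampled, Finset.mem_filter, Finset.mem_univ, true_and, Option.not_mem_none,
    false_imp_iff, implies_true, Option.mem_some_iff, forall_eq']
  tauto

theorem abs_quantize_sub_le (x : I) : |(quantize T x : ℝ) - T * (x : ℝ)| ≤ 1 := by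
  have h0 : 0 ≤ (x : ℝ) * T := mul_nonneg x.2.1 (by positivity)
  have h1 := Nat.floor_le h0
  have h2 := Nat.lt_floor_add_one ((x : ℝ) * T)
  rw [quantize, abs_le]
  constructor <;> linarith

/-- The two terms of `width` are the statistical deviation, scaled by `T`, and a rounding error of
at most 1 per sample. -/
theorem Accurate.abs_sub_le {ν : Bandit K} {x : Fin T × Fin M × Fin K → I} (h : Accurate ν x)
    {j : ℕ} (hj : j < T) (o : Option (Fin M)) (k : Fin K)
    (hc : (sampled M K T j o k).card = samples M K T j) :
    |((∑ e ∈ sampled M K T j o k, quantize T (x e) : ℕ) : ℝ) -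
      T * samples M K T j * ν.mean k| ≤ width M K T j := by
  classical
  have h1 := h ⟨j, hj⟩ o k
  simp only at h1
  rw [hc] at h1
  have h2 : ((∑ e ∈ sampled M K T j o k, quantize T (x e) : ℕ) : ℝ) -
      T * samples M K T j * ν.mean k =
      T * ∑ e ∈ sampled M K T j o k, ((x e : ℝ) - ν.mean e.2.2) +
        ∑ e ∈ sampled M K T j o k, ((quantize T (x e) : ℝ) - T * (x e : ℝ)) := by
    have h3 : ∑ e ∈ sampled M K T j o k, ν.mean e.2.2 = samples M K T j * ν.mean k := by
      rw [← hc, ← nsmul_eq_mul, ← Finset.sum_const]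
      refine Finset.sum_congr rfl fun e he => ?_
      simp only [sampled, Finset.mem_filter] at he
      rw [he.2.2.2.2]
    rw [Finset.sum_sub_distrib, Finset.sum_sub_distrib, h3, ← Finset.mul_sum]
    push_cast
    ring
  rw [h2, width]
  refine (abs_add_le _ _).trans (add_le_add ?_ ?_)
  · rw [abs_mul, Nat.abs_cast]
    gcongr
  · refine (Finset.abs_sum_le_sum_abs _ _).trans ?_
    refine (Finset.sum_le_sum fun e _ => abs_quantize_sub_le (x e)).trans ?_
    simp [hc]

/-- Bound for the gaps of the arms that can be pulled in epoch `j`. -/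
noncomputable def gapBound (M K T : ℕ) : ℕ → ℝ
  | 0 => 1
  | j + 1 => open Classical in if IsLocal M T j then radius 1 K T j else radius M K T j

theorem radius_of_local [NeZero K] (ht : 2 < T) {j : ℕ} (hjT : 2 ^ j ≤ T) (hj : IsLocal M T j) {g : ℝ}
    (hg : g ≤ 1) (h : T * samples M K T j * g ≤ 4 * width M K T j) :
    g ≤ gapBound M K T (j + 1) := by
  classical
  have hL := one_le_log ht
  have hT1 : (1 : ℝ) ≤ T := by exact_mod_cast (by omega : 1 ≤ T)
  have hK1 : (1 : ℝ) ≤ K := by exact_mod_cast NeZero.one_le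
  have h2T : ((2 : ℝ) ^ j) ≤ T := by exact_mod_cast hjT
  simp only [gapBound, if_pos hj, radius]
  refine gap_le_radius (t := T) (N := samples M K T j) hg (by linarith) hK1 hL
    (by positivity) ?_ (by positivity) ?_ h
  · push_cast
    nlinarith
  · rcases samples_local (NeZero.pos K) hj with h1 | ⟨h1, h2⟩
    · left
      rw [one_mul]
      exact_mod_cast h1
    · right
      rw [one_mul]
      exact ⟨by exact_mod_cast h1, by exact_mod_cast h2⟩

theorem radius_of_global [NeZero K] (ht : 2 < T) (hM : 0 < M) (hMT : M < T) {j : ℕ} (hjT : 2 ^ j ≤ T)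
    (hj : ¬ IsLocal M T j) {g : ℝ} (hg : g ≤ 1)
    (h : T * samples M K T j * g ≤ 4 * width M K T j) : g ≤ gapBound M K T (j + 1) := by
  classical
  have hL := one_le_log ht
  have hK1 : (1 : ℝ) ≤ K := by exact_mod_cast NeZero.one_le
  simp only [gapBound, if_neg hj, radius]
  refine gap_le_radius (t := T) (N := samples M K T j) hg (by positivity) hK1 hL
    (by positivity) ?_ (by positivity) ?_ h
  · exact_mod_cast Nat.mul_le_mul hMT.le hjT
  · rcases samples_global hM (NeZero.pos K) hj with h1 | ⟨h1, h2⟩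
    · left
      exact_mod_cast h1
    · right
      exact ⟨by exact_mod_cast h1, by exact_mod_cast h2⟩

end

/-! ### The invariant along the run -/

section

variable {M K T : ℕ}

/-- The memory of an agent is in order before pull `n`, in epoch `j`, where `b` is the best arm. -/
structure Sound (T : ℕ) (ν : Bandit K) (x : Fin T × Fin M × Fin K → I) (b : Fin K) (j n : ℕ)
    (i : Fin M) (s : Agent K) : Prop where
  clock : s.clock = n
  sums : ∀ k ∈ s.active, s.sums k = collected x j n i k
  owns : ¬ IsLocal M T j → ∀ k ∈ s.active, Owns M K i k
  gap : ∀ k ∈ s.active, ν.mean b - ν.mean k ≤ gapBound M K T j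
  gap_fallback : ν.mean b - ν.mean s.fallback ≤ gapBound M K T j
  best_mem : IsLocal M T j ∨ Owns M K i b → b ∈ s.active

/-- Elimination with accurate sums is correct. -/
theorem elimination_gap {c μb μk w Yb Yk V : ℝ} (hb : |Yb - c * μb| ≤ w) (hk : |Yk - c * μk| ≤ w)
    (h1 : Yb ≤ V) (h2 : V ≤ Yk + 2 * w) : c * (μb - μk) ≤ 4 * w := by
  rw [abs_le] at hb hk
  linarith

theorem elimination_survive {c μb μk w Yb Yk : ℝ} (hb : |Yb - c * μb| ≤ w)
    (hk : |Yk - c * μk| ≤ w) (hc : 0 ≤ c) (h : μk ≤ μb) : Yk ≤ Yb + 2 * w := by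
  rw [abs_le] at hb hk
  have := mul_le_mul_of_nonneg_left h hc
  linarith

theorem mean_mem (ν : Bandit K) (k : Fin K) : ν.mean k ∈ Set.Icc (0 : ℝ) 1 := by
  constructor
  · exact integral_nonneg fun x => x.2.1
  · calc ν.mean k ≤ ∫ _x : I, (1 : ℝ) ∂(ν k : Measure I) :=
        integral_mono_of_nonneg (Filter.Eventually.of_forall fun x => x.2.1)
          (integrable_const _) (Filter.Eventually.of_forall fun x => x.2.2)
      _ = 1 := by simp

theorem gap_le_one (ν : Bandit K) (b k : Fin K) : ν.mean b - ν.mean k ≤ 1 := by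
  linarith [(mean_mem ν b).2, (mean_mem ν k).1]

theorem width_nonneg (M K T j : ℕ) : 0 ≤ width M K T j := by
  unfold width
  positivity

variable {ν : Bandit K} {x : Fin T × Fin M × Fin K → I} {b : Fin K}

variable [NeZero K]

/-- A scheduled active arm is the arm actually pulled, so the observed reward is the table entry
that `collected` adds. -/
theorem Sound.record {n : ℕ} {i : Fin M} {s : Agent K} (h : Sound T ν x b (epoch n) n i s)
    (hn : n < T) :
    Sound T ν x b (epoch n) (n + 1) i
      (record M K T i s (quantize T (x (⟨n, hn⟩, i, choice M K T i s)))) where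
  clock := by rw [Elimination.record, h.clock]
  sums := by
    intro k hk
    replace hk : k ∈ s.active := hk
    have he : k ∈ s.active ∧ IsSlot M K T s.clock i k ↔ IsSlot M K T n i k := by
      rw [h.clock]
      exact and_iff_right hk
    simp only [Elimination.record, collected_succ x hn, h.sums k hk]
    by_cases hs : IsSlot M K T n i k
    · rw [if_pos hs, if_pos (he.2 hs), choice_eq hk (he.2 hs).2]
    · rw [if_neg hs, if_neg (mt he.1 hs)]
  owns := h.owns
  gap := h.gap
  gap_fallback := h.gap_fallback
  best_mem := h.best_mem

/-- Each agent eliminates on its own samples. If the next epoch is global, it also discards the arms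
it does not own; therefore only owners must retain the best arm. -/
theorem Sound.localUpdate {n : ℕ} {i : Fin M} {s : Agent K}
    (h : Sound T ν x b (epoch n) (n + 1) i s) (hx : Accurate ν x)
    (hb : ∀ k, ν.mean k ≤ ν.mean b) (ht : 2 < T) (hn : n + 1 < T)
    (hne : epoch n ≠ epoch (n + 1)) (hl : IsLocal M T (epoch n)) :
    Sound T ν x b (epoch (n + 1)) (n + 1) i (localUpdate M K T i s) := by
  classical
  obtain ⟨hj, h2⟩ := epoch_succ_of_ne hne
  have hjT : epoch n < T := epoch_lt_of_lt (by omega)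
  have hpT : 2 ^ epoch n ≤ T := by
    have := two_pow_epoch_le n
    omega
  have hsum : ∀ k ∈ s.active,
      |(s.sums k : ℝ) - T * samples M K T (epoch n) * ν.mean k| ≤ width M K T (epoch n) := by
    intro k hk
    rw [h.sums k hk, ← sum_sampled_some x (by omega) i k]
    exact hx.abs_sub_le hjT _ _ (card_sampled_local hl (by omega) i k)
  have hbm : b ∈ s.active := h.best_mem (Or.inl hl)
  have htop : s.top ∈ s.active := Elimination.best_mem _ ⟨b, hbm⟩
  have hclock : s.clock - 1 = n := by rw [h.clock]; rfl
  have hw := width_nonneg M K T (epoch n)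
  have hbt : (s.sums b : ℝ) ≤ s.sums s.top := by exact_mod_cast le_best s.sums hbm
  refine ⟨h.clock, ?_, ?_, ?_, ?_, ?_⟩
  · intro k _
    rw [hj, collected_eq_zero x (by omega)]
    rfl
  · intro hl' k hk
    simp only [Elimination.localUpdate, Finset.mem_filter, h.clock] at hk
    exact hk.2.2.resolve_left hl'
  · intro k hk
    simp only [Elimination.localUpdate, Finset.mem_filter, hclock] at hk
    rw [hj]
    exact radius_of_local ht hpT hl (gap_le_one ν b k)
      (elimination_gap (hsum b hbm) (hsum k hk.1) hbt hk.2.1)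
  · rw [hj]
    exact radius_of_local ht hpT hl (gap_le_one ν b s.top)
      (elimination_gap (hsum b hbm) (hsum _ htop) hbt
        (show (s.sums s.top : ℝ) ≤ s.sums s.top + 2 * width M K T (epoch n) by linarith))
  · intro hor
    simp only [Elimination.localUpdate, Finset.mem_filter, hclock]
    rw [h.clock]
    exact ⟨hbm, elimination_survive (hsum b hbm) (hsum _ htop) (by positivity) (hb _), hor⟩

theorem clock_update (i : Fin M) (s : Agent K) (msg : Message (T ^ 4)) :
    (update M K T i s msg).clock = s.clock := by
  rw [update]
  split_ifs <;> rfl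

variable [NeZero T]

/-- The memory of an agent after the communication that precedes pull `n`. -/
noncomputable def synced (ω : (protocol M K T).Outcome T) (n : ℕ) (i : Fin M) : Agent K :=
  ((protocol M K T).communicate ((protocol M K T).config ω n)).agents i

/-- The memory of an agent before the communication that precedes pull `n`. -/
noncomputable def unsynced (ω : (protocol M K T).Outcome T) (n : ℕ) (i : Fin M) : Agent K :=
  ((protocol M K T).config ω n).agents i

theorem synced_eq (ω : (protocol M K T).Outcome T) (n : ℕ) (i : Fin M) :
    synced ω n i = update M K T i (unsynced ω n i)
      (answer M K T (fun i' => report M K T (unsynced ω n i')) i) := rfl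

theorem unsynced_zero (ω : (protocol M K T).Outcome T) (i : Fin M) :
    unsynced ω 0 i = ⟨0, Finset.univ, 0, 0⟩ := rfl

theorem unsynced_succ (ω : (protocol M K T).Outcome T) {n : ℕ} (h : n < T) (i : Fin M) :
    unsynced ω (n + 1) i = record M K T i (synced ω n i)
      (quantize T (ω.2.2 (⟨n, h⟩, i, choice M K T i (synced ω n i)))) := by
  rw [unsynced, Protocol.config, dif_pos h]
  rfl

theorem clock_unsynced (ω : (protocol M K T).Outcome T) {n : ℕ} (h : n ≤ T) (i : Fin M) :
    (unsynced ω n i).clock = n := by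
  induction n with
  | zero => rfl
  | succ n ih =>
    rw [unsynced_succ ω h, record, synced_eq, clock_update, ih (by omega)]

theorem not_boundary_zero : ¬ Boundary 0 := fun h => h rfl

/-- All agents must be sound at once: the leader dominates the best arm only because every owner of
the best arm has kept it. -/
theorem Sound.globalUpdate {n : ℕ} {s : Fin M → Agent K}
    (h : ∀ i, Sound T ν x b (epoch n) (n + 1) i (s i)) (hx : Accurate ν x)
    (hb : ∀ k, ν.mean k ≤ ν.mean b) (ht : 2 < T) (hMT : M < T) (hKT : K < T) (hn : n + 1 < T)
    (hne : epoch n ≠ epoch (n + 1)) (hl : ¬ IsLocal M T (epoch n)) (i : Fin M) :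
    Sound T ν x b (epoch (n + 1)) (n + 1) i
      (globalUpdate M K T (s i) (Collected.reply M T s i)) := by
  classical
  obtain ⟨hj, h2⟩ := epoch_succ_of_ne hne
  have hM : 0 < M := i.pos
  have hjT : epoch n < T := epoch_lt_of_lt (by omega)
  have hpT : 2 ^ epoch n ≤ T := by
    have := two_pow_epoch_le n
    omega
  have hclock : ∀ i, (s i).clock - 1 = n := fun i => by rw [(h i).clock]; rfl
  have hc : Collected M K T s (fun i k => collected x (epoch n) (n + 1) i k) :=
    { boundary := fun i => by
        rw [Boundary, hclock, (h i).clock]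
        exact hne
      not_local := fun i => by rwa [hclock]
      owns := fun i => (h i).owns hl
      sums := fun i => (h i).sums
      eq_zero := fun i k => collected_eq_zero_of_not_owns x hl
      le := fun i k => collected_le x _ _ i k
      lt_horizon := hMT
      arms_lt := hKT }
  have hsum : ∀ k : Fin K,
      |((∑ i, collected x (epoch n) (n + 1) i k : ℕ) : ℝ) -
        T * samples M K T (epoch n) * ν.mean k| ≤ width M K T (epoch n) := by
    intro k
    rw [← sum_sampled_none x (by omega) k]
    exact hx.abs_sub_le hjT _ _ (card_sampled_global hM hl (by omega) k)
  have hbm : ∀ i : Fin M, Owns M K i b → b ∈ (s i).active := fun i ho =>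
    (h i).best_mem (Or.inr ho)
  obtain ⟨i₀, hi₀⟩ : ∃ i : Fin M, Owns M K i b := by
    have hcard := card_owners hM b
    have hpos := groupSize_pos hM (NeZero.pos K)
    rw [← hcard, Finset.card_pos] at hpos
    obtain ⟨i₀, hi₀⟩ := hpos
    exact ⟨i₀, by simpa using hi₀⟩
  have hp : (pooled M K T fun i => report M K T (s i)).Nonempty :=
    ⟨_, hc.top_mem_pooled hbm hi₀⟩
  have hlead : ((∑ i, collected x (epoch n) (n + 1) i b : ℕ) : ℝ) ≤
      ((∑ i, collected x (epoch n) (n + 1) i (Collected.leader M T s) : ℕ) : ℝ) := by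
    exact_mod_cast hc.sum_le_sum_leader hbm hi₀
  have hw := width_nonneg M K T (epoch n)
  -- Once global, epochs remain global, so ownership never has to be reassigned.
  have hgl : ¬ IsLocal M T (epoch (n + 1)) := by
    rw [hj]
    simp only [IsLocal, not_lt] at hl ⊢
    exact hl.trans (Nat.mul_le_mul_left _ (Nat.pow_le_pow_right (by norm_num) (by omega)))
  refine ⟨(h i).clock, ?_, ?_, ?_, ?_, ?_⟩
  · intro k _
    rw [hj, collected_eq_zero x (by omega)]
    rfl
  · intro _ k hk
    exact (h i).owns hl k (hc.of_mem_globalUpdate hp hk).1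
  · intro k hk
    have hk2 := (hc.of_mem_globalUpdate hp hk).2
    rw [hclock] at hk2
    rw [hj]
    exact radius_of_global ht hM hMT hpT hl (gap_le_one ν b k)
      (elimination_gap (hsum b) (hsum k) hlead hk2)
  · rw [hj, hc.fallback_globalUpdate hp]
    exact radius_of_global ht hM hMT hpT hl (gap_le_one ν b _)
      (elimination_gap (hsum b) (hsum _) hlead (by linarith))
  · intro hor
    refine hc.mem_globalUpdate hbm (hor.resolve_left hgl) ?_
    rw [hclock]
    exact elimination_survive (hsum b) (hsum _) (by positivity) (hb _)

theorem sound_synced (ω : (protocol M K T).Outcome T) (hx : Accurate ν ω.2.2)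
    (hb : ∀ k, ν.mean k ≤ ν.mean b) (ht : 2 < T) (hMT : M < T) (hKT : K < T) {n : ℕ}
    (hn : n < T) (i : Fin M) : Sound T ν ω.2.2 b (epoch n) n i (synced ω n i) := by
  classical
  induction n generalizing i with
  | zero =>
    have h0 : synced ω 0 i = ⟨0, Finset.univ, 0, 0⟩ := by
      rw [synced_eq, update, if_neg, unsynced_zero]
      exact not_boundary_zero
    rw [h0, epoch_zero]
    refine ⟨rfl, ?_, ?_, ?_, gap_le_one ν b _, fun _ => Finset.mem_univ b⟩
    · intro k _
      rw [collected_eq_zero _ (by norm_num)]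
      rfl
    · intro hl
      -- Epoch 0 is local because `M < T`, so starting with all arms active is consistent.
      exact absurd (by simpa [IsLocal] using hMT) hl
    · intro k _
      exact gap_le_one ν b k
  | succ n ih =>
    have h1 : ∀ i, Sound T ν ω.2.2 b (epoch n) (n + 1) i (unsynced ω (n + 1) i) := fun i => by
      rw [unsynced_succ ω (by omega)]
      exact (ih (by omega) i).record (by omega)
    rw [synced_eq, update]
    have hclock : (unsynced ω (n + 1) i).clock = n + 1 := (h1 i).clock
    simp only [Boundary, hclock, Nat.add_sub_cancel]
    by_cases he : epoch n = epoch (n + 1)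
    · rw [if_neg (not_not.2 he), ← he]
      exact h1 i
    · rw [if_pos he]
      split_ifs with hl
      · exact (h1 i).localUpdate hx hb ht hn he hl
      · exact Sound.globalUpdate h1 hx hb ht hMT hKT hn he hl i

theorem gap_pulledArm_le (ω : (protocol M K T).Outcome T) (hx : Accurate ν ω.2.2)
    (hb : ∀ k, ν.mean k ≤ ν.mean b) (ht : 2 < T) (hMT : M < T) (hKT : K < T) (t : Fin T)
    (i : Fin M) :
    ν.mean b - ν.mean ((protocol M K T).pulledArm ω t i) ≤ gapBound M K T (epoch t) := by
  have h := sound_synced ω hx hb ht hMT hKT t.2 i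
  have h1 : (protocol M K T).pulledArm ω t i = choice M K T i (synced ω t i) := rfl
  rw [h1]
  rcases choice_mem (T := T) i (synced ω t i) with h2 | h2
  · exact h.gap _ h2
  · rw [h2]
    exact h.gap_fallback

end

/-! ### Summation of the gap bounds -/

theorem sum_inv_sqrt_le (N : ℕ) : ∑ n ∈ Finset.range N, 1 / √((n : ℝ) + 1) ≤ 2 * √N := by
  induction N with
  | zero => simp
  | succ N ih =>
    rw [Finset.sum_range_succ]
    push_cast
    have h1 : 0 < √((N : ℝ) + 1) := Real.sqrt_pos.2 (by positivity)
    have h2 : √(N : ℝ) ^ 2 = N := Real.sq_sqrt (by positivity)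
    have h3 : √((N : ℝ) + 1) ^ 2 = N + 1 := Real.sq_sqrt (by positivity)
    -- The right-hand side telescopes.
    have h4 : 1 / √((N : ℝ) + 1) ≤ 2 * √((N : ℝ) + 1) - 2 * √(N : ℝ) := by
      rw [div_le_iff₀ h1]
      nlinarith [sq_nonneg (√((N : ℝ) + 1) - √(N : ℝ))]
    linarith

theorem sqrt_div_le {y a b : ℝ} (hy : 0 ≤ y) (ha : 0 < a) (hb : 0 < b) (h : b ≤ 4 * a) :
    √(y / a) ≤ 2 * √(y / b) := by
  have h2 : (2 : ℝ) = √4 := by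
    rw [show (4 : ℝ) = 2 ^ 2 by norm_num, Real.sqrt_sq (by norm_num)]
  rw [h2, ← Real.sqrt_mul (by norm_num)]
  apply Real.sqrt_le_sqrt
  rw [mul_div_assoc', div_le_div_iff₀ ha hb]
  nlinarith

/-- The arms of an epoch are judged by the data of the preceding one, and `n + 1` is at most four
times the length of that epoch. The square root turns this into a factor 2, whence `36 = 2 * 18`;
the same factor 4 appears in the range of the local term. -/
theorem gapBound_epoch_le {M K T : ℕ} (hM : 0 < M) (hK : 0 < K) (hMT : M < T) (ht : 2 < T)
    (n : ℕ) :
    gapBound M K T (epoch n) ≤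
      36 * ((if M * (n + 1) < 4 * T then √(K * Real.log T / (n + 1 : ℝ)) else 0) +
        √(K * Real.log T / (M * (n + 1 : ℝ)))) := by
  classical
  have hL := one_le_log ht
  have hK1 : (1 : ℝ) ≤ K := by exact_mod_cast hK
  have hM1 : (0 : ℝ) < M := by exact_mod_cast hM
  have hy : 1 ≤ K * Real.log T := one_le_mul_of_one_le_of_one_le hK1 hL
  have h1 := two_pow_epoch_le n
  have h2 := lt_two_pow_epoch n
  rcases he : epoch n with _ | j
  · rw [he] at h2
    obtain rfl : n = 0 := by
      simp only [zero_add, pow_one] at h2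
      omega
    rw [if_pos (by omega), gapBound]
    have h3 : 1 ≤ √(K * Real.log T / ((0 : ℕ) + 1 : ℝ)) := by
      rw [Real.one_le_sqrt]
      simpa using hy
    have h4 := Real.sqrt_nonneg (K * Real.log T / (M * ((0 : ℕ) + 1 : ℝ)))
    linarith
  · rw [he] at h1 h2
    have h3 : n + 1 ≤ 4 * 2 ^ j := by
      rw [pow_succ, pow_succ] at h2
      omega
    have h3' : (n : ℝ) + 1 ≤ 4 * 2 ^ j := by exact_mod_cast h3
    have hs1 := Real.sqrt_nonneg (K * Real.log T / (n + 1 : ℝ))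
    have hs2 := Real.sqrt_nonneg (K * Real.log T / (M * (n + 1 : ℝ)))
    rw [gapBound]
    split_ifs with hl hc hc
    · have := sqrt_div_le (y := K * Real.log T) (a := ((1 * 2 ^ j : ℕ) : ℝ)) (b := n + 1)
        (by linarith) (by positivity) (by positivity) (by push_cast; linarith)
      rw [radius]
      linarith
    · exfalso
      simp only [IsLocal] at hl
      have := Nat.mul_le_mul_left M h3
      have : M * (4 * 2 ^ j) = 4 * (M * 2 ^ j) := by ring
      omega
    all_goals
      have := sqrt_div_le (y := K * Real.log T) (a := ((M * 2 ^ j : ℕ) : ℝ)) (b := M * (n + 1))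
        (by linarith) (by positivity) (by positivity) (by push_cast; nlinarith)
      rw [radius]
      linarith

/-- The local term, with about `4 * T / M` steps, contributes `4 * √(M K T log T)` and the global
one `2 * √(M K T log T)`, so the constant is `36 * 6`. -/
theorem sum_gapBound_le {M K T : ℕ} (hM : 0 < M) (hK : 0 < K) (hMT : M < T) (ht : 2 < T) :
    (M : ℝ) * ∑ n ∈ Finset.range T, gapBound M K T (epoch n) ≤
      216 * √(M * K * T * Real.log T) := by
  classical
  have hL := one_le_log ht
  have hM1 : (0 : ℝ) < M := by exact_mod_cast hM
  set y : ℝ := K * Real.log T with hy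
  have hy0 : 0 ≤ y := by positivity
  have hsplit : ∀ c : ℝ, 0 < c → ∀ n : ℕ, √(y / (c * (n + 1 : ℝ))) =
      √(y / c) * (1 / √((n : ℝ) + 1)) := by
    intro c hc n
    rw [← div_div, Real.sqrt_div (by positivity)]
    ring
  have hA : ∑ n ∈ Finset.range T, (if M * (n + 1) < 4 * T then √(y / (n + 1 : ℝ)) else 0) ≤
      √y * (2 * √(4 * T / M)) := by
    rw [← Finset.sum_filter]
    calc ∑ n ∈ Finset.range T with M * (n + 1) < 4 * T, √(y / (n + 1 : ℝ))
        = ∑ n ∈ Finset.range T with M * (n + 1) < 4 * T, √y * (1 / √((n : ℝ) + 1)) := by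
          refine Finset.sum_congr rfl fun n _ => ?_
          have := hsplit 1 one_pos n
          rwa [one_mul, div_one] at this
      _ ≤ ∑ n ∈ Finset.range (4 * T / M), √y * (1 / √((n : ℝ) + 1)) := by
          refine Finset.sum_le_sum_of_subset_of_nonneg (fun n hn => ?_)
            fun n _ _ => by positivity
          rw [Finset.mem_filter] at hn
          rw [Finset.mem_range, Nat.lt_iff_add_one_le, Nat.le_div_iff_mul_le hM, mul_comm]
          exact hn.2.le
      _ = √y * ∑ n ∈ Finset.range (4 * T / M), 1 / √((n : ℝ) + 1) := by rw [Finset.mul_sum]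
      _ ≤ √y * (2 * √((4 * T / M : ℕ) : ℝ)) := by
          gcongr
          exact sum_inv_sqrt_le _
      _ ≤ √y * (2 * √(4 * T / M)) := by
          gcongr
          exact Nat.cast_div_le.trans (by push_cast; exact le_rfl)
  have hB : ∑ n ∈ Finset.range T, √(y / (M * (n + 1 : ℝ))) ≤ √(y / M) * (2 * √T) := by
    rw [Finset.sum_congr rfl fun n _ => hsplit M hM1 n, ← Finset.mul_sum]
    gcongr
    exact sum_inv_sqrt_le T
  have hMA : M * (√y * (2 * √(4 * T / M))) = 4 * √(M * K * T * Real.log T) := by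
    have h4 : √(4 * T / M : ℝ) = 2 * √(T / M) := by
      rw [mul_div_assoc, Real.sqrt_mul (by norm_num), show (4 : ℝ) = 2 ^ 2 by norm_num,
        Real.sqrt_sq (by norm_num)]
    have h5 : (M * K * T * Real.log T : ℝ) = M ^ 2 * (y * (T / M)) := by
      rw [hy]
      field_simp
    rw [h4, h5, Real.sqrt_mul (sq_nonneg _), Real.sqrt_sq hM1.le, Real.sqrt_mul hy0]
    ring
  have hMB : M * (√(y / M) * (2 * √T)) = 2 * √(M * K * T * Real.log T) := by
    have h5 : (M * K * T * Real.log T : ℝ) = M ^ 2 * (y / M * T) := by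
      rw [hy]
      field_simp
    rw [h5, Real.sqrt_mul (sq_nonneg _), Real.sqrt_sq hM1.le, Real.sqrt_mul (by positivity)]
    ring
  calc (M : ℝ) * ∑ n ∈ Finset.range T, gapBound M K T (epoch n)
      ≤ M * ∑ n ∈ Finset.range T,
        36 * ((if M * (n + 1) < 4 * T then √(y / (n + 1 : ℝ)) else 0) +
          √(y / (M * (n + 1 : ℝ)))) := by
        gcongr with n _
        exact gapBound_epoch_le hM hK hMT ht n
    _ = 36 * (M * ∑ n ∈ Finset.range T, (if M * (n + 1) < 4 * T then √(y / (n + 1 : ℝ)) else 0))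
        + 36 * (M * ∑ n ∈ Finset.range T, √(y / (M * (n + 1 : ℝ)))) := by
        rw [← Finset.mul_sum, Finset.sum_add_distrib]
        ring
    _ ≤ 36 * (M * (√y * (2 * √(4 * T / M)))) + 36 * (M * (√(y / M) * (2 * √T))) := by gcongr
    _ = 216 * √(M * K * T * Real.log T) := by
        rw [hMA, hMB]
        ring

/-! ### Communication cost -/

/-- The steps before which the agents communicate. -/
def Communicates (M T n : ℕ) : Prop := Boundary n ∧ ¬ IsLocal M T (epoch (n - 1))

-- A communication is determined by the epoch `j` that has just ended. Being global requires `T ≤ M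
-- * 2 ^ j`, and ending within the horizon requires `2 ^ (j + 1) ≤ T`, which leaves `log₂ M` values
-- of `j`.
open Classical in
theorem card_communicates_le (M T : ℕ) :
    ((Finset.range T).filter (Communicates M T)).card ≤ Nat.log 2 M := by
  have hinj : Set.InjOn (fun n => epoch (n - 1))
      ((Finset.range T).filter (Communicates M T) : Finset ℕ) := by
    intro n hn n' hn' he
    simp only [Finset.coe_filter, Set.mem_ofPred_eq] at hn hn'
    rcases n with _ | n
    · exact absurd rfl hn.2.1
    rcases n' with _ | n'
    · exact absurd rfl hn'.2.1
    have h1 := (epoch_succ_of_ne hn.2.1).2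
    have h2 := (epoch_succ_of_ne hn'.2.1).2
    simp only [Nat.add_sub_cancel] at he h1 h2
    rw [he] at h1
    omega
  rw [← Finset.card_image_of_injOn hinj]
  have hsub : ((Finset.range T).filter (Communicates M T)).image (fun n => epoch (n - 1)) ⊆
      Finset.Ico (Nat.log 2 T - Nat.log 2 M) (Nat.log 2 T) := by
    intro j hj
    simp only [Finset.mem_image, Finset.mem_filter, Finset.mem_range] at hj
    obtain ⟨n, ⟨hnT, hb, hl⟩, rfl⟩ := hj
    rcases n with _ | n
    · exact absurd rfl hb
    have h1 := (epoch_succ_of_ne hb).2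
    simp only [Nat.add_sub_cancel] at hl h1 ⊢
    rw [Finset.mem_Ico]
    have hT : T ≠ 0 := by omega
    constructor
    · simp only [IsLocal, not_lt] at hl
      have h3 := Nat.pow_log_le_self 2 hT
      have h4 := Nat.lt_pow_succ_log_self (b := 2) (by norm_num) M
      have h5 : 2 ^ Nat.log 2 T < 2 ^ (Nat.log 2 M + 1 + epoch n) := by
        rw [pow_add]
        calc 2 ^ Nat.log 2 T ≤ M * 2 ^ epoch n := h3.trans hl
          _ < 2 ^ (Nat.log 2 M + 1) * 2 ^ epoch n := by gcongr
      have := (Nat.pow_lt_pow_iff_right (by norm_num)).1 h5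
      omega
    · exact Nat.lt_of_succ_le (Nat.le_log_of_pow_le (by norm_num) (by omega))
  refine (Finset.card_le_card hsub).trans ?_
  rw [Nat.card_Ico]
  omega

section

variable {M K T : ℕ} [NeZero K] [NeZero T]

theorem length_report_le (s : Agent K) : (report M K T s).length ≤ 2 := by
  rw [report]
  split_ifs <;> simp

theorem report_eq_nil_of_not {s : Agent K} (h : ¬ Communicates M T s.clock) :
    report M K T s = [] := by
  rw [report, if_neg]
  rintro ⟨h1, h2, -⟩
  exact h ⟨h1, h2⟩

theorem length_answer_le (msg : Fin M → Message (T ^ 4)) (i : Fin M) :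
    (answer M K T msg i).length ≤ 3 := by
  rw [answer]
  split_ifs <;> simp

/-- Every arm has a positive number of owners, so no arm is pooled without reports and the server
stays silent too. -/
theorem answer_eq_nil {msg : Fin M → Message (T ^ 4)} (h : ∀ i, msg i = []) (i : Fin M) :
    answer M K T msg i = [] := by
  classical
  rw [answer, if_neg]
  rintro ⟨k, hk⟩
  simp only [pooled, Finset.mem_filter, Finset.mem_univ, true_and] at hk
  have := groupSize_pos i.pos (NeZero.pos K)
  rw [← hk, Finset.card_pos] at this
  obtain ⟨i', hi'⟩ := this
  simp [reporters, h] at hi'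

-- A communication costs at most two packets up and three packets down per agent.
open Classical in
theorem packets_le (ω : (protocol M K T).Outcome T) {n : ℕ} (hn : n ≤ T) :
    ((protocol M K T).config ω n).packets ≤
      5 * M * ((Finset.range n).filter (Communicates M T)).card := by
  induction n with
  | zero => exact Nat.zero_le _
  | succ n ih =>
    have h : ((protocol M K T).config ω (n + 1)).packets =
        ((protocol M K T).config ω n).packets +
          ∑ i, (report M K T (unsynced ω n i)).length +
          ∑ i, (answer M K T (fun i' => report M K T (unsynced ω n i')) i).length := by
      rw [Protocol.config, dif_pos (show n < T from hn)]
      rfl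
    have ih := ih (by omega)
    rw [h, Finset.range_add_one, Finset.filter_insert]
    by_cases hc : Communicates M T n
    · rw [if_pos hc, Finset.card_insert_of_notMem (by simp)]
      have h1 : ∑ i, (report M K T (unsynced ω n i)).length ≤ M * 2 := by
        refine (Finset.sum_le_sum fun i _ => length_report_le _).trans ?_
        simp
      have h2 : ∑ i, (answer M K T (fun i' => report M K T (unsynced ω n i')) i).length
          ≤ M * 3 := by
        refine (Finset.sum_le_sum fun i _ => length_answer_le _ i).trans ?_
        simp
      rw [mul_add]
      omega
    · have hr : ∀ i, report M K T (unsynced ω n i) = [] := fun i =>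
        report_eq_nil_of_not (by rwa [clock_unsynced ω (by omega)])
      rw [if_neg hc]
      simp only [hr, answer_eq_nil (K := K) (fun _ => rfl)]
      simpa using ih

theorem cost_le (ω : (protocol M K T).Outcome T) (hM : 0 < M) :
    ((protocol M K T).cost ω : ℝ) ≤ 10 * (M * Real.log (M * K)) := by
  classical
  have h1 : (protocol M K T).cost ω ≤ 5 * M * Nat.log 2 M :=
    (packets_le ω le_rfl).trans (Nat.mul_le_mul_left _ (card_communicates_le M T))
  have hM1 : (1 : ℝ) ≤ M := by exact_mod_cast hM
  have hK1 : (1 : ℝ) ≤ K := by exact_mod_cast NeZero.one_le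
  have hlog0 : 0 ≤ Real.log M := Real.log_nonneg hM1
  have h2 : (Nat.log 2 M : ℝ) ≤ 2 * Real.log M := by
    refine (Real.natLog_le_logb M 2).trans ?_
    rw [Real.logb, div_le_iff₀ (Real.log_pos (by norm_num))]
    have := Real.log_two_gt_d9
    push_cast
    nlinarith
  have h3 : Real.log M ≤ Real.log (M * K) :=
    Real.log_le_log (by linarith) (le_mul_of_one_le_right (by linarith) hK1)
  calc ((protocol M K T).cost ω : ℝ) ≤ ((5 * M * Nat.log 2 M : ℕ) : ℝ) := by exact_mod_cast h1
    _ = 5 * M * (Nat.log 2 M : ℝ) := by push_cast; ring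
    _ ≤ 5 * M * (2 * Real.log (M * K)) := by gcongr; linarith
    _ = 10 * (M * Real.log (M * K)) := by ring

/-! ### Measurability and expected regret -/

theorem config_congr {ω ω' : (protocol M K T).Outcome T}
    (h : ∀ e, quantize T (ω.2.2 e) = quantize T (ω'.2.2 e)) (n : ℕ) :
    (protocol M K T).config ω n = (protocol M K T).config ω' n := by
  induction n with
  | zero => rfl
  | succ n ih =>
    rw [Protocol.config, Protocol.config]
    split_ifs with hn
    · rw [ih]
      simp only [Protocol.pull, protocol, h]
    · exact ih

/-- The run depends on the rewards only through their rounded values, which form a countable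
discrete space, and every function on such a space is measurable. -/
theorem measurable_of_quantize {f : (protocol M K T).Outcome T → ℝ}
    (hf : ∀ ω ω' : (protocol M K T).Outcome T,
      (∀ e, quantize T (ω.2.2 e) = quantize T (ω'.2.2 e)) → f ω = f ω') : Measurable f := by
  let q : (protocol M K T).Outcome T → (Fin T × Fin M × Fin K → ℕ) := fun ω e =>
    quantize T (ω.2.2 e)
  have hq : Measurable q := measurable_pi_lambda _ fun e =>
    (measurable_quantize T).comp ((measurable_pi_apply e).comp (measurable_snd.comp measurable_snd))
  have hfac : Function.FactorsThrough f q := fun ω ω' h => hf ω ω' fun e => congrFun h e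
  rw [← hfac.extend_comp fun _ => 0]
  exact Measurable.of_discrete.comp hq

theorem measurable_regret (ν : Bandit K) :
    Measurable fun ω => (protocol M K T).regret (T := T) ν ω :=
  measurable_of_quantize fun ω ω' h => by
    simp only [Protocol.regret, Protocol.pulledArm, config_congr h]

theorem measurable_cost :
    Measurable fun ω => ((protocol M K T).cost (T := T) ω : ℝ) :=
  measurable_of_quantize fun ω ω' h => by simp only [Protocol.cost, config_congr h]

instance (ν : Bandit K) : IsProbabilityMeasure ((protocol M K T).law T ν) := by
  unfold Protocol.law
  infer_instance

theorem exists_best (ν : Bandit K) :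
    ∃ b, ν.bestMean = ν.mean b ∧ ∀ k, ν.mean k ≤ ν.mean b := by
  obtain ⟨b, hb⟩ := Finite.exists_max ν.mean
  exact ⟨b, le_antisymm (ciSup_le hb) (le_ciSup (Set.finite_range ν.mean).bddAbove b), hb⟩

theorem regret_nonneg (ν : Bandit K) (ω : (protocol M K T).Outcome T) :
    0 ≤ (protocol M K T).regret ν ω := by
  obtain ⟨b, hb, hmax⟩ := exists_best ν
  rw [Protocol.regret, hb]
  exact Finset.sum_nonneg fun t _ => Finset.sum_nonneg fun i _ => sub_nonneg.2 (hmax _)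

theorem regret_le (ν : Bandit K) (ω : (protocol M K T).Outcome T) :
    (protocol M K T).regret ν ω ≤ M * T := by
  obtain ⟨b, hb, -⟩ := exists_best ν
  rw [Protocol.regret, hb]
  calc _ ≤ ∑ _t : Fin T, ∑ _i : Fin M, (1 : ℝ) :=
        Finset.sum_le_sum fun t _ => Finset.sum_le_sum fun i _ => gap_le_one ν b _
    _ = M * T := by simp [mul_comm]

theorem regret_le_of_accurate (ν : Bandit K) (ω : (protocol M K T).Outcome T)
    (hx : Accurate ν ω.2.2) (hM : 0 < M) (ht : 2 < T) (hMT : M < T) (hKT : K < T) :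
    (protocol M K T).regret ν ω ≤ 216 * √(M * K * T * Real.log T) := by
  obtain ⟨b, hb, hmax⟩ := exists_best ν
  refine le_trans ?_ (sum_gapBound_le hM (NeZero.pos K) hMT ht)
  rw [Protocol.regret, hb]
  calc _ ≤ ∑ t : Fin T, ∑ _i : Fin M, gapBound M K T (epoch t) :=
        Finset.sum_le_sum fun t _ => Finset.sum_le_sum fun i _ =>
          gap_pulledArm_le ω hx hmax ht hMT hKT t i
    _ = M * ∑ t : Fin T, gapBound M K T (epoch t) := by simp [Finset.mul_sum]
    _ = M * ∑ n ∈ Finset.range T, gapBound M K T (epoch n) := by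
        rw [Fin.sum_univ_eq_sum_range fun n => gapBound M K T (epoch n)]

theorem law_real_not_accurate_le (ν : Bandit K) (ht : 2 < T) (hMT : M < T) (hKT : K < T) :
    ((protocol M K T).law T ν).real {ω | ¬ Accurate ν ω.2.2} ≤ 1 / T := by
  have hmp : MeasurePreserving (fun ω : (protocol M K T).Outcome T => ω.2.2)
      ((protocol M K T).law T ν)
      (Measure.pi fun e : Fin T × Fin M × Fin K => (ν e.2.2 : Measure I)) :=
    measurePreserving_snd.comp measurePreserving_snd
  refine le_trans (le_of_eq ?_) (measureReal_not_accurate_le hMT hKT ht ν)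
  exact congrArg ENNReal.toReal
    (hmp.measure_preimage (measurableSet_accurate ν).compl.nullMeasurableSet)

theorem integrable_regret (ν : Bandit K) :
    Integrable (fun ω => (protocol M K T).regret ν ω) ((protocol M K T).law T ν) :=
  Integrable.of_bound (measurable_regret ν).aestronglyMeasurable (M * T)
    (Filter.Eventually.of_forall fun ω => by
      rw [Real.norm_of_nonneg (regret_nonneg ν ω)]
      exact regret_le ν ω)

theorem integrable_cost (hM : 0 < M) (ν : Bandit K) :
    Integrable (fun ω => ((protocol M K T).cost ω : ℝ)) ((protocol M K T).law T ν) :=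
  Integrable.of_bound measurable_cost.aestronglyMeasurable (10 * (M * Real.log (M * K)))
    (Filter.Eventually.of_forall fun ω => by
      rw [Real.norm_of_nonneg (Nat.cast_nonneg _)]
      exact cost_le ω hM)

theorem integral_regret_le (hM : 0 < M) (ht : 2 < T) (hMT : M < T) (hKT : K < T)
    (ν : Bandit K) :
    ∫ ω, (protocol M K T).regret ν ω ∂((protocol M K T).law T ν) ≤
      217 * √(M * K * T * Real.log T) := by
  classical
  set B : Set ((protocol M K T).Outcome T) := {ω | ¬ Accurate ν ω.2.2} with hB
  have hBm : MeasurableSet B :=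
    (measurable_snd.comp measurable_snd) (measurableSet_accurate ν).compl
  set G := √(M * K * T * Real.log T) with hG
  have hG0 : 0 ≤ G := Real.sqrt_nonneg _
  have hT0 : (0 : ℝ) < T := by positivity
  have hpt : ∀ ω, (protocol M K T).regret ν ω ≤ 216 * G + B.indicator (fun _ => (M * T : ℝ)) ω := by
    intro ω
    by_cases hω : Accurate ν ω.2.2
    · rw [Set.indicator_of_notMem (show ω ∉ B from fun h => h hω), add_zero]
      exact regret_le_of_accurate ν ω hω hM ht hMT hKT
    · rw [Set.indicator_of_mem (show ω ∈ B from hω)]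
      linarith [regret_le ν ω]
  have hint : Integrable (B.indicator fun _ => (M * T : ℝ)) ((protocol M K T).law T ν) :=
    (integrable_const _).indicator hBm
  -- The failure event has probability at most `1 / T` and regret at most `M * T`, so it contributes
  -- at most `M`; this raises the constant from 216 to 217.
  have hMG : (M : ℝ) ≤ G := by
    refine Real.le_sqrt_of_sq_le ?_
    have h1 : (M : ℝ) ≤ T := by exact_mod_cast hMT.le
    have h2 : (1 : ℝ) ≤ K := by exact_mod_cast NeZero.one_le
    calc (M : ℝ) ^ 2 = M * 1 * M * 1 := by ring
      _ ≤ M * K * T * Real.log T := by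
        gcongr
        exact one_le_log ht
  calc ∫ ω, (protocol M K T).regret ν ω ∂((protocol M K T).law T ν)
      ≤ ∫ ω, (216 * G + B.indicator (fun _ => (M * T : ℝ)) ω) ∂((protocol M K T).law T ν) :=
        integral_mono (integrable_regret ν) ((integrable_const _).add hint) hpt
    _ = 216 * G + ((protocol M K T).law T ν).real B * (M * T) := by
        rw [integral_add (integrable_const _) hint, integral_indicator_const _ hBm]
        simp
    _ ≤ 216 * G + 1 / T * (M * T) := by
        gcongr
        exact law_real_not_accurate_le ν ht hMT hKT
    _ = 216 * G + M := by field_simp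
    _ ≤ 217 * G := by linarith

end

end DistributedMAB.Elimination

theorem theorem6 :
    ∃ (C : ℝ) (b R : ℕ), ∀ M K T : ℕ, 1 ≤ M → 1 ≤ K →
      M < T → K < T → 2 < T → (M : ℝ) * Real.log M / K < T →
      ∃ P : DistributedMAB.Protocol M K R (T ^ b),
        (∀ ω : P.Outcome T,
          (P.cost ω : ℝ) ≤ C * (M * Real.log (M * K) + K)) ∧
        ∀ ν : DistributedMAB.Bandit K,
          MeasureTheory.Integrable (fun ω => P.regret ν ω) (P.law T ν) ∧
          ∫ ω, P.regret ν ω ∂(P.law T ν) ≤ C * Real.sqrt (M * K * T * Real.log T) ∧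
          MeasureTheory.Integrable (fun ω => (P.cost ω : ℝ)) (P.law T ν) ∧
          ∫ ω, (P.cost ω : ℝ) ∂(P.law T ν) ≤ C * (M * Real.log (M * K)) := by
  -- The regret dictates the constant 217, packets have size `T ^ 4`, and one exchange per step is
  -- enough.
  refine ⟨217, 4, 1, fun M K T hM hK hMT hKT hT _ => ?_⟩
  have : NeZero K := ⟨by omega⟩
  have : NeZero T := ⟨by omega⟩
  have hM1 : (1 : ℝ) ≤ M := by exact_mod_cast hM
  have hK1 : (1 : ℝ) ≤ K := by exact_mod_cast hK
  have hlog : 0 ≤ (M : ℝ) * Real.log (M * K) :=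
    mul_nonneg (by linarith) (Real.log_nonneg (one_le_mul_of_one_le_of_one_le hM1 hK1))
  have hcost : ∀ ω : (DistributedMAB.Elimination.protocol M K T).Outcome T,
      ((DistributedMAB.Elimination.protocol M K T).cost ω : ℝ) ≤
        217 * (M * Real.log (M * K)) := fun ω => by
    linarith [DistributedMAB.Elimination.cost_le ω hM]
  refine ⟨DistributedMAB.Elimination.protocol M K T, fun ω => ?_, fun ν => ⟨?_, ?_, ?_, ?_⟩⟩
  · linarith [hcost ω]
  · exact DistributedMAB.Elimination.integrable_regret ν
  · exact DistributedMAB.Elimination.integral_regret_le hM hT hMT hKT ν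
  · exact DistributedMAB.Elimination.integrable_cost hM ν
  · calc _ ≤ ∫ _ω, (217 * (M * Real.log (M * K)) : ℝ)
          ∂((DistributedMAB.Elimination.protocol M K T).law T ν) :=
        MeasureTheory.integral_mono (DistributedMAB.Elimination.integrable_cost hM ν)
          (MeasureTheory.integrable_const _) hcost
      _ = 217 * (M * Real.log (M * K)) := by simp
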